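/- Let $N\ge 1$, $\tfrac12<s<1$, and write $x_1$ for the first coordinate of $x\in\mathbb R^N$. A function $\phi$ is $C^{1,1}$ at $x$ (with constant $M$) if there are $p\in\mathbb R^N$ and $\eta_0>0$ with $|\phi(x+h)-\phi(x)-p\cdot h|\le M|h|^2$ for $|h|<\eta_0$; then $\nabla\phi(x):=p$. For such $\phi$, bounded and Borel, put $$\Delta^s_\infty\phi(x)=\int_0^\infty\frac{\phi(x+\eta v)+\phi(x-\eta v)-2\phi(x)}{\eta^{1+2s}}\,d\eta,\quad v=\frac{\nabla\phi(x)}{|\nabla\phi(x)|},\qquad\text{if }\nabla\phi(x)\ne0,$$ $$\Delta^s_\infty\phi(x)=\sup_{|y|=1}\int_0^\infty\frac{\phi(x+\eta y)-\phi(x)}{\eta^{1+2s}}\,d\eta+\inf_{|z|=1}\int_0^\infty\frac{\phi(x-\eta z)-\phi(x)}{\eta^{1+2s}}\,d\eta\qquad\text{if }\nabla\phi(x)=0.$$ An upper semicontinuous $u:\mathbb R^N\to\mathbb R$ is a subsolution at $x_0$, written $\Delta^s_\infty u(x_0)\ge0$, if for every $r>0$ and every $\phi$ that is $C^{1,1}$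 at $x_0$ and continuous on $\overline{B_r(x_0)}$, with $\phi(x_0)=u(x_0)$ and $\phi>u$ on $B_r(x_0)\setminus\{x_0\}$, the function $\tilde u$ equal to $\phi$ in $B_r(x_0)$ and to $u$ outside satisfies $\Delta^s_\infty\tilde u(x_0)\ge0$. Let $\theta\in(0,\pi/2)$ and $C^+=\{x\ne0:\cos\theta<x_1/|x|\le1\}$. Let the obstacles $\Gamma^\pm:\mathbb R^N\to\mathbb R$ satisfy the following assumptions. 1. $0\le\Gamma^-<\Gamma^+\le1$. 2. Both $\Gamma^+$ and $\Gamma^-$ are Lipschitz with constant $L_0$. 3. $\Gamma^+$ is uniformly $C^{1,1}$ inside $\{\Gamma^+<1\}$, and $\Gamma^-$ inside $\{\Gamma^->0\}$ (that is, $C^{1,1}$ at every point of the set, with one constant $M$ for all of them). 4. $\Gamma^+(x)\to0$ as $x_1\to-\infty$ and $\Gamma^-(x)\to1$ as $x_1\to+\infty$, uniformly in the other variables. 5. $\Gamma^\pm(x+y)\ge\Gamma^\pm(x)$ for all $x\in\mathbb R^N$, $y\in C^+$; and for every $M>0$ there is $l_M>0$ with $|\Gamma^+(x)-\Gamma^+(y)|\ge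 l_M|x-y|$ for $x,y\in\{\Gamma^+<1\}\cap\{|x_1|\le M\}$, $x-y\in C^+$, and $|\Gamma^-(x)-\Gamma^-(y)|\ge l_M|x-y|$ for $x,y\in\{\Gamma^->0\}\cap\{|x_1|\le M\}$, $x-y\in C^+$. 6. There are $L_M$ ($M>0$) with $L_M\to0$ as $M\to\infty$ and $|\Gamma^+(x)-\Gamma^+(y)|+|\Gamma^-(x)-\Gamma^-(y)|\le L_M|x-y|$ whenever $M<|x_1|,|y_1|<2M$. 7. There are $\alpha>2s$, $C>0$, $M_0>0$, $\rho_0\in(0,1)$ such that for every $\tilde x$ with $\tilde x_1>M_0$ there is $A>0$ with $$A^s\Big(1-\Gamma^-(\tilde x)+\tfrac{|\nabla\Gamma^-(\tilde x)|^2}{4A}\Big)^{1-s}\le C|\tilde x_1|^{-\alpha},\qquad 1-\Gamma^-(\tilde x)+\tfrac{|\nabla\Gamma^-(\tilde x)|^2}{4A}<\rho_0,$$ and $\Gamma^-(x)\le\Gamma^-(\tilde x)+\nabla\Gamma^-(\tilde x)\cdot(x-\tilde x)+A|x-\tilde x|^2$ for all $x$; and for every $\tilde x$ with $\tilde x_1<-M_0$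 there is $A>0$ with $$A^s\Big(\Gamma^+(\tilde x)+\tfrac{|\nabla\Gamma^+(\tilde x)|^2}{4A}\Big)^{1-s}\le C|\tilde x_1|^{-\alpha},\qquad \Gamma^+(\tilde x)+\tfrac{|\nabla\Gamma^+(\tilde x)|^2}{4A}<\rho_0,$$ and $\Gamma^+(x)\ge\Gamma^+(\tilde x)+\nabla\Gamma^+(\tilde x)\cdot(x-\tilde x)-A|x-\tilde x|^2$ for all $x$. Let $\mathcal F$ be the set of $u:\mathbb R^N\to\mathbb R$ with $\Gamma^-\le u\le\Gamma^+$ and $\Delta^s_\infty u(x)\ge0$ at every $x$ with $u(x)>\Gamma^-(x)$, and let $$U(x)=\sup\{u(x):u\in\mathcal F\}$$ be the Perron solution of the double obstacle problem. **Theorem.** There is a constant $A_\theta\ge1$, depending only on $\theta$, such that $U$ is $(A_\theta L_0)$-Lipschitz. Moreover there are constants $C,r_0>0$, which may depend on $N,s,\Gamma^\pm$ but not on the point $x$, such that for all $r\in(0,r_0)$: * if $U(x)=\Gamma^+(x)$, $\nabla\Gamma^+(x)\neq0$ and $y=\nabla\Gamma^+(x)/|\nabla\Gamma^+(x)|$,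 then $|\Gamma^+(x+ry)-U(x+ry)|\le C\,r^{1+(s-1/2)}$; * if $U(x)=\Gamma^-(x)$, $\nabla\Gamma^-(x)\neq0$ and $y=\nabla\Gamma^-(x)/|\nabla\Gamma^-(x)|$, then $|U(x-ry)-\Gamma^-(x-ry)|\le C\,r^{1+(s-1/2)}$. -/

import Mathlib

open Set Filter Topology MeasureTheory

noncomputable section

namespace NonlocalTugOfWar

/-- The Euclidean space `ℝ^N`. For `N ≥ 1` the coordinate `x 0` is the component along `e₁`. -/
abbrev E (N : ℕ) : Type := EuclideanSpace ℝ (Fin N)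

/-- `φ` has at `x` the first order expansion with slope `p`, with a quadratic error of constant
`M` on the ball of radius `η₀`. -/
def HasC11Expansion {N : ℕ} (φ : E N → ℝ) (x p : E N) (M η₀ : ℝ) : Prop :=
  ∀ h : E N, ‖h‖ < η₀ → |φ (x + h) - φ x - inner ℝ p h| ≤ M * ‖h‖ ^ 2

/-- `φ` is `C^{1,1}` at the point `x`. The vector `p` is then the gradient of `φ` at `x`. -/
def IsC11At {N : ℕ} (φ : E N → ℝ) (x : E N) : Prop :=
  ∃ (p : E N) (M η₀ : ℝ), 0 < M ∧ 0 < η₀ ∧ HasC11Expansion φ x p M η₀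

/-- `φ` is uniformly `C^{1,1}` inside the open set `S`: it is `C^{1,1}` at every point of `S`,
with one constant `M` for all the points. The radius of the expansion may depend on the point, as
the expansion has to live inside `S`. -/
def UniformlyC11Inside {N : ℕ} (φ : E N → ℝ) (S : Set (E N)) : Prop :=
  ∃ M : ℝ, 0 < M ∧ ∀ x ∈ S, ∃ (p : E N) (η₀ : ℝ), 0 < η₀ ∧ HasC11Expansion φ x p M η₀

open Classical in
/-- The infinity fractional Laplacian of `φ` at `x`. When `1/2 < s < 1`, `φ` is `C^{1,1}` at `x`,
bounded, and Borel measurable, all the integrals converge absolutely, and the supremum and the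
infimum over the unit sphere are finite. -/
def infFracLaplacian {N : ℕ} (s : ℝ) (φ : E N → ℝ) (x : E N) : ℝ :=
  if gradient φ x ≠ 0 then
    ∫ η in Ioi (0 : ℝ),
      (φ (x + η • (‖gradient φ x‖⁻¹ • gradient φ x))
        + φ (x - η • (‖gradient φ x‖⁻¹ • gradient φ x)) - 2 * φ x) / η ^ (1 + 2 * s)
  else
    (⨆ y : Metric.sphere (0 : E N) 1,
        ∫ η in Ioi (0 : ℝ), (φ (x + η • (y : E N)) - φ x) / η ^ (1 + 2 * s))
      + ⨅ z : Metric.sphere (0 : E N) 1,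
        ∫ η in Ioi (0 : ℝ), (φ (x - η • (z : E N)) - φ x) / η ^ (1 + 2 * s)

open Classical in
/-- The function equal to `φ` in the open ball `B_r(x₀)` and to `u` outside. -/
def cutIn {N : ℕ} (u φ : E N → ℝ) (x₀ : E N) (r : ℝ) : E N → ℝ :=
  fun x => if x ∈ Metric.ball x₀ r then φ x else u x

/-- `u` is a (viscosity) subsolution at `x₀`, that is `Δ^s_∞ u(x₀) ≥ 0`: `u` is upper
semicontinuous on `ℝ^N` and, whenever `φ` touches `u` from above at `x₀` in `B_r(x₀)`, the operator
is nonnegative at `x₀` on `u` modified to be `φ` in `B_r(x₀)`. -/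
def IsSubsolutionAt {N : ℕ} (s : ℝ) (u : E N → ℝ) (x₀ : E N) : Prop :=
  UpperSemicontinuous u ∧
    ∀ (r : ℝ) (φ : E N → ℝ), 0 < r → IsC11At φ x₀ → ContinuousOn φ (Metric.closedBall x₀ r) →
      φ x₀ = u x₀ → (∀ x ∈ Metric.ball x₀ r \ {x₀}, u x < φ x) →
        0 ≤ infFracLaplacian s (cutIn u φ x₀ r) x₀

/-- The open cone `C⁺` of opening `θ` around `e₁`. -/
def cone (N : ℕ) [NeZero N] (θ : ℝ) : Set (E N) :=
  {x | x ≠ 0 ∧ Real.cos θ < x 0 / ‖x‖ ∧ x 0 / ‖x‖ ≤ 1}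

/-- The standing assumptions on the upper obstacle `Γp` (that is, `Γ⁺`) and the lower obstacle `Γm`
(that is, `Γ⁻`), for the exponent `s`, the cone opening `θ` and the Lipschitz constant `L₀`. -/
structure ObstacleAssumptions {N : ℕ} [NeZero N] (s θ L₀ : ℝ) (Γp Γm : E N → ℝ) : Prop where
  /-- `0 ≤ Γ⁻ < Γ⁺ ≤ 1` -/
  lower_nonneg : ∀ x, 0 ≤ Γm x
  lower_lt_upper : ∀ x, Γm x < Γp x
  upper_le_one : ∀ x, Γp x ≤ 1
  /-- `L₀` is a Lipschitz constant for both obstacles. -/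
  upper_lipschitz : ∀ x y, |Γp x - Γp y| ≤ L₀ * ‖x - y‖
  lower_lipschitz : ∀ x y, |Γm x - Γm y| ≤ L₀ * ‖x - y‖
  upper_C11 : UniformlyC11Inside Γp {x | Γp x < 1}
  lower_C11 : UniformlyC11Inside Γm {x | 0 < Γm x}
  /-- `Γ⁺ → 0` as `x₁ → -∞` and `Γ⁻ → 1` as `x₁ → +∞`, uniformly in the other variables. -/
  upper_tendsto : Tendsto Γp (comap (fun x : E N => x 0) atBot) (𝓝 0)
  lower_tendsto : Tendsto Γm (comap (fun x : E N => x 0) atTop) (𝓝 1)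
  /-- Monotonicity in the directions of the cone. -/
  upper_monotone : ∀ x, ∀ y ∈ cone N θ, Γp x ≤ Γp (x + y)
  lower_monotone : ∀ x, ∀ y ∈ cone N θ, Γm x ≤ Γm (x + y)
  /-- The monotonicity is strict away from `0` and `1`. -/
  strictly_monotone : ∀ M : ℝ, 0 < M → ∃ l : ℝ, 0 < l ∧
    (∀ x y, Γp x < 1 → Γp y < 1 → |x 0| ≤ M → |y 0| ≤ M → x - y ∈ cone N θ →
      l ≤ |Γp x - Γp y| / ‖x - y‖) ∧
    (∀ x y, 0 < Γm x → 0 < Γm y → |x 0| ≤ M → |y 0| ≤ M → x - y ∈ cone N θ →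
      l ≤ |Γm x - Γm y| / ‖x - y‖)
  /-- The obstacles flatten at infinity. -/
  flat_at_infinity : ∃ L : ℝ → ℝ, Tendsto L atTop (𝓝 0) ∧
    ∀ M : ℝ, 0 < M → ∀ x y : E N, x ≠ y → M < |x 0| → |x 0| < 2 * M → M < |y 0| → |y 0| < 2 * M →
      |Γp x - Γp y| / ‖x - y‖ + |Γm x - Γm y| / ‖x - y‖ ≤ L M
  /-- Near `x₁ = +∞` the lower obstacle is touched from above, and near `x₁ = -∞` the upper obstacle
  is touched from below, by a paraboloid whose opening `a` is controlled. -/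
  paraboloids : ∃ α C M₀ ρ₀ : ℝ, 2 * s < α ∧ 0 < C ∧ 0 < M₀ ∧ 0 < ρ₀ ∧ ρ₀ < 1 ∧
    (∀ z : E N, M₀ < z 0 → ∃ a : ℝ, 0 < a ∧
      a ^ s * (1 - Γm z + ‖gradient Γm z‖ ^ 2 / (4 * a)) ^ (1 - s) ≤ C * |z 0| ^ (-α) ∧
      1 - Γm z + ‖gradient Γm z‖ ^ 2 / (4 * a) < ρ₀ ∧
      ∀ x, Γm x ≤ Γm z + inner ℝ (gradient Γm z) (x - z) + a * ‖x - z‖ ^ 2) ∧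
    (∀ z : E N, z 0 < -M₀ → ∃ a : ℝ, 0 < a ∧
      a ^ s * (Γp z + ‖gradient Γp z‖ ^ 2 / (4 * a)) ^ (1 - s) ≤ C * |z 0| ^ (-α) ∧
      Γp z + ‖gradient Γp z‖ ^ 2 / (4 * a) < ρ₀ ∧
      ∀ x, Γp z + inner ℝ (gradient Γp z) (x - z) - a * ‖x - z‖ ^ 2 ≤ Γp x)

/-- The family `𝓕` of admissible subsolutions of the double obstacle problem. -/
def admissible {N : ℕ} (s : ℝ) (Γp Γm : E N → ℝ) : Set (E N → ℝ) :=
  {u | (∀ x, Γm x < u x → IsSubsolutionAt s u x) ∧ (∀ x, Γm x ≤ u x) ∧ ∀ x, u x ≤ Γp x}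

/-- The solution of the double obstacle problem: the pointwise supremum of the admissible
subsolutions. As `Γ⁻` is admissible (when it lies below `Γ⁺`) and all of them lie below `Γ⁺`, this is
the supremum of a nonempty bounded set of reals. -/
def obstacleSolution {N : ℕ} (s : ℝ) (Γp Γm : E N → ℝ) (x : E N) : ℝ :=
  sSup ((fun u : E N → ℝ => u x) '' admissible s Γp Γm)

end NonlocalTugOfWar

end

/-! Write `U` for the Perron solution. Lipschitz bound: if `u` is admissible, so is the maximum of
`Γm` and the translate `u (· + h) - L₀ * ‖h‖`. The lowering keeps the translate below `Γp`, and puts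
every point where it exceeds `Γm` over a point where `u` does. Comparing with `U` gives the constant
`L₀` itself, so `A = 1` works and the cone plays no role.

Contact estimates: where the gradient is nonzero the operator is a weighted integral of second
differences along one line. Near a contact point semiconcavity of `Γp` (semiconvexity of `Γm`)
bounds these differences by a multiple of `min (η ^ 2) 1`, whose weighted integral converges because
`s < 1`. Let `δ` be the gap between `U` and the obstacle at distance `r` along the gradient. Both
functions being Lipschitz, a gap comparable to `δ` persists on an interval of length comparable to
`δ / L`, where the weight is at least `(2 * r) ^ (-(1 + 2 * s))`. The sign of the operator then
forces `δ ^ 2 ≤ C * r ^ (1 + 2 * s)`, that is, `δ ≤ C' * r ^ (s + 1 / 2)`. This balance is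
`deficit_le_of_integral_nonneg`.

For `Γp` (`upper_contact`) it is read off a subsolution almost touching `Γp`, tested at a nearby
point with a paraboloid. For `Γm` (`lower_contact`) it is proved by contradiction: were the gap too
large, a paraboloid tangent to `Γm` and slightly raised could be glued to an admissible function,
and the result would be admissible and exceed `U` at the contact point. The global paraboloid bounds
come from the pointwise `C^{1,1}` hypothesis through `LocalUpperSupport.global`. -/

namespace NonlocalTugOfWar

/-! ### The weight `min (η ^ 2) 1 / η ^ (1 + 2 * s)` -/

theorem integrableOn_weight {s : ℝ} (hs : 0 < s) (hs1 : s < 1) :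
    IntegrableOn (fun η : ℝ => min (η ^ 2) 1 / η ^ (1 + 2 * s)) (Ioi 0) := by
  have hU : Ioi (0 : ℝ) = Ioc 0 1 ∪ Ioi 1 := (Ioc_union_Ioi_eq_Ioi zero_le_one).symm
  rw [hU]
  refine IntegrableOn.union ?_ ?_
  · have h := (intervalIntegral.intervalIntegrable_rpow' (a := 0) (b := 1)
      (show -1 < 1 - 2 * s by linarith)).1
    refine h.congr_fun (fun η hη => ?_) measurableSet_Ioc
    have h1 : η ^ 2 ≤ 1 := pow_le_one₀ hη.1.le hη.2
    simp only [min_eq_left h1]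
    rw [← Real.rpow_natCast, ← Real.rpow_sub hη.1]
    congr 1
    push_cast
    ring
  · have h := integrableOn_Ioi_rpow_of_lt (show -(1 + 2 * s) < -1 by linarith) zero_lt_one
    refine h.congr_fun (fun η hη => ?_) measurableSet_Ioi
    have hη' : (1 : ℝ) < η := hη
    have h1 : 1 ≤ η ^ 2 := one_le_pow₀ hη'.le
    simp only [min_eq_right h1]
    rw [Real.rpow_neg (by linarith), one_div]

theorem integral_weight_nonneg (s : ℝ) :
    0 ≤ ∫ η in Ioi (0 : ℝ), min (η ^ 2) 1 / η ^ (1 + 2 * s) :=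
  setIntegral_nonneg measurableSet_Ioi fun η (hη : 0 < η) => by positivity

theorem integrableOn_div_of_abs_le {s A : ℝ} (hs : 0 < s) (hs1 : s < 1) {F : ℝ → ℝ}
    (hF : Measurable F) (hb : ∀ η, 0 < η → |F η| ≤ A * min (η ^ 2) 1) :
    IntegrableOn (fun η => F η / η ^ (1 + 2 * s)) (Ioi 0) := by
  refine Integrable.mono' ((integrableOn_weight hs hs1).const_mul A) ?_ ?_
  · exact (hF.div (measurable_id.pow_const _)).aestronglyMeasurable
  · refine (ae_restrict_mem measurableSet_Ioi).mono fun η hη => ?_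
    have hη' : 0 < η := hη
    rw [Real.norm_eq_abs, abs_div, abs_of_pos (Real.rpow_pos_of_pos hη' _), ← mul_div_assoc]
    exact div_le_div_of_nonneg_right (hb η hη') (Real.rpow_pos_of_pos hη' _).le

theorem abs_integral_div_le {s A : ℝ} (hs : 0 < s) (hs1 : s < 1) {F : ℝ → ℝ}
    (hb : ∀ η, 0 < η → |F η| ≤ A * min (η ^ 2) 1) :
    |∫ η in Ioi (0 : ℝ), F η / η ^ (1 + 2 * s)|
      ≤ A * ∫ η in Ioi (0 : ℝ), min (η ^ 2) 1 / η ^ (1 + 2 * s) := by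
  rw [← integral_const_mul, ← Real.norm_eq_abs]
  refine norm_integral_le_of_norm_le ((integrableOn_weight hs hs1).const_mul A) ?_
  refine (ae_restrict_mem measurableSet_Ioi).mono fun η hη => ?_
  have hη' : 0 < η := hη
  rw [Real.norm_eq_abs, abs_div, abs_of_pos (Real.rpow_pos_of_pos hη' _), ← mul_div_assoc]
  exact div_le_div_of_nonneg_right (hb η hη') (Real.rpow_pos_of_pos hη' _).le

/-- A function below `A * min (η ^ 2) 1`, and lower by `d` on `[r, r + l]`, whose weighted integral
is nonnegative: the deficit `d * l` is controlled by `r ^ (1 + 2 * s)`. -/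
theorem deficit_le_of_integral_nonneg {s A r l d : ℝ} (hs : 0 < s) (hs1 : s < 1)
    (hr : 0 < r) (hl : 0 ≤ l) (hlr : l ≤ r) (hd : 0 ≤ d) {F : ℝ → ℝ}
    (hF : IntegrableOn (fun η => F η / η ^ (1 + 2 * s)) (Ioi 0))
    (h0 : 0 ≤ ∫ η in Ioi (0 : ℝ), F η / η ^ (1 + 2 * s))
    (hle : ∀ η, 0 < η → F η ≤ A * min (η ^ 2) 1)
    (hle' : ∀ η ∈ Icc r (r + l), F η ≤ A * min (η ^ 2) 1 - d) :
    d * l ≤ A * (∫ η in Ioi (0 : ℝ), min (η ^ 2) 1 / η ^ (1 + 2 * s)) * (2 * r) ^ (1 + 2 * s) := by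
  have h2r : 0 < (2 * r) ^ (1 + 2 * s) := Real.rpow_pos_of_pos (by linarith) _
  -- As `l ≤ r`, the interval lies in `[r, 2 * r]`, so the deficit divided by the weight's
  -- denominator is at least this constant.
  set c : ℝ := d / (2 * r) ^ (1 + 2 * s) with hc
  have hw := (integrableOn_weight hs hs1).const_mul A
  have hsub : Icc r (r + l) ⊆ Ioi 0 := fun η hη => lt_of_lt_of_le hr hη.1
  have hi : IntegrableOn (indicator (Icc r (r + l)) fun _ => c) (Ioi 0) := by
    refine ((integrable_indicator_iff measurableSet_Icc).2 ?_).integrableOn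
    exact integrableOn_const (by simp)
  have hval : ∫ η in Ioi (0 : ℝ), indicator (Icc r (r + l)) (fun _ => c) η = l * c := by
    rw [setIntegral_indicator measurableSet_Icc, inter_eq_self_of_subset_right hsub]
    simp [hl]
  have key : ∫ η in Ioi (0 : ℝ), F η / η ^ (1 + 2 * s) ≤
      ∫ η in Ioi (0 : ℝ), (A * (min (η ^ 2) 1 / η ^ (1 + 2 * s))
        - indicator (Icc r (r + l)) (fun _ => c) η) := by
    refine setIntegral_mono_on hF (hw.sub hi) measurableSet_Ioi fun η hη => ?_
    have hη' : 0 < η := hη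
    have hp : 0 < η ^ (1 + 2 * s) := Real.rpow_pos_of_pos hη' _
    by_cases hm : η ∈ Icc r (r + l)
    · rw [indicator_of_mem hm, ← mul_div_assoc]
      have h1 := div_le_div_of_nonneg_right (hle' η hm) hp.le
      rw [sub_div] at h1
      have h2 : c ≤ d / η ^ (1 + 2 * s) := by
        refine div_le_div_of_nonneg_left hd hp ?_
        exact Real.rpow_le_rpow hη'.le (by linarith [hm.2]) (by linarith)
      linarith
    · rw [indicator_of_notMem hm, ← mul_div_assoc, sub_zero]
      exact div_le_div_of_nonneg_right (hle η hη') hp.le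
  rw [integral_sub hw hi, hval, integral_const_mul] at key
  have h3 : l * c ≤ A * ∫ η in Ioi (0 : ℝ), min (η ^ 2) 1 / η ^ (1 + 2 * s) := by linarith
  calc d * l = l * c * (2 * r) ^ (1 + 2 * s) := by rw [hc]; field_simp
    _ ≤ _ := mul_le_mul_of_nonneg_right h3 h2r.le

/-- The exponent `1 + (s - 1 / 2)` is half of `1 + 2 * s`. -/
theorem le_sqrt_mul_rpow {s δ D r : ℝ} (hr : 0 < r) (hD : 0 ≤ D)
    (h : δ ^ 2 ≤ D * r ^ (1 + 2 * s)) : δ ≤ √D * r ^ (1 + (s - 1 / 2)) := by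
  have h1 : D * r ^ (1 + 2 * s) = (√D * r ^ (1 + (s - 1 / 2))) ^ 2 := by
    rw [mul_pow, Real.sq_sqrt hD, ← Real.rpow_natCast (r ^ _), ← Real.rpow_mul hr.le]
    congr 2
    push_cast
    ring
  rw [h1] at h
  exact le_of_sq_le_sq h (by positivity)

/-! ### Pointwise `C^{1,1}` expansions -/

variable {N : ℕ}

theorem HasC11Expansion.hasGradientAt {φ : E N → ℝ} {x p : E N} {M η₀ : ℝ} (hη : 0 < η₀)
    (h : HasC11Expansion φ x p M η₀) : HasGradientAt φ p x := by
  rw [hasGradientAt_iff_isLittleO_nhds_zero]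
  have h1 : (fun h : E N => φ (x + h) - φ x - inner ℝ p h) =O[𝓝 0] fun h : E N => ‖h‖ ^ 2 := by
    refine Asymptotics.IsBigO.of_bound M ?_
    filter_upwards [Metric.ball_mem_nhds (0 : E N) hη] with k hk
    rw [mem_ball_zero_iff] at hk
    simpa using h k hk
  exact h1.trans_isLittleO (Asymptotics.isLittleO_norm_pow_id one_lt_two)

theorem HasC11Expansion.cutIn {u φ : E N → ℝ} {x p : E N} {M η₀ r : ℝ}
    (h : HasC11Expansion φ x p M η₀) (hr : 0 < r) :
    HasC11Expansion (cutIn u φ x r) x p M (min η₀ r) := by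
  intro k hk
  have h1 : x + k ∈ Metric.ball x r := by
    simpa using hk.trans_le (min_le_right _ _)
  simpa [NonlocalTugOfWar.cutIn, h1, hr] using h k (hk.trans_le (min_le_left _ _))

/-- Between `η₀` and `1` the bound `B` is at most `B / η₀ ^ 2 * η ^ 2`; this accounts for the last
term of the constant. -/
theorem abs_le_mul_min_sq {F M B η₀ η : ℝ} (hη₀ : 0 < η₀) (hM : 0 ≤ M) (hB : 0 ≤ B)
    (h1 : η < η₀ → |F| ≤ M * η ^ 2) (h2 : |F| ≤ B) :
    |F| ≤ (M + B + B / η₀ ^ 2) * min (η ^ 2) 1 := by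
  have hBd : 0 ≤ B / η₀ ^ 2 := by positivity
  rcases le_total (η ^ 2) 1 with h | h
  · rw [min_eq_left h]
    by_cases hlt : η < η₀
    · refine (h1 hlt).trans (mul_le_mul_of_nonneg_right ?_ (sq_nonneg _))
      linarith
    · have h3 : η₀ ^ 2 ≤ η ^ 2 := pow_le_pow_left₀ hη₀.le (not_lt.1 hlt) 2
      have h4 : B ≤ B / η₀ ^ 2 * η ^ 2 := by
        rw [div_mul_eq_mul_div, le_div_iff₀ (by positivity)]
        exact mul_le_mul_of_nonneg_left h3 hB
      have h5 : 0 ≤ (M + B) * η ^ 2 := by positivity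
      nlinarith
  · rw [min_eq_right h]
    linarith

theorem abs_sub_le_of_abs_le {a b B : ℝ} (ha : |a| ≤ B) (hb : |b| ≤ B) : |a - b| ≤ 4 * B := by
  rw [abs_le] at *
  constructor <;> linarith

theorem abs_second_diff_le_of_abs_le {a b c B : ℝ} (ha : |a| ≤ B) (hb : |b| ≤ B) (hc : |c| ≤ B) :
    |a + b - 2 * c| ≤ 4 * B := by
  rw [abs_le] at *
  constructor <;> linarith

theorem HasC11Expansion.abs_sub_le {f : E N → ℝ} {x v : E N} {M η₀ B η : ℝ} (hη₀ : 0 < η₀)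
    (hM : 0 ≤ M) (h : HasC11Expansion f x 0 M η₀) (hB : ∀ z, |f z| ≤ B) (hv : ‖v‖ = 1)
    (hη : 0 < η) :
    |f (x + η • v) - f x| ≤ (M + 4 * B + 4 * B / η₀ ^ 2) * min (η ^ 2) 1 := by
  have hB0 : 0 ≤ B := (abs_nonneg _).trans (hB x)
  refine abs_le_mul_min_sq hη₀ hM (by linarith) (fun hlt => ?_)
    (abs_sub_le_of_abs_le (hB _) (hB _))
  have hn : ‖η • v‖ = η := by rw [norm_smul, hv, mul_one, Real.norm_of_nonneg hη.le]
  simpa [hn] using h (η • v) (by rwa [hn])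

theorem HasC11Expansion.abs_second_diff_le {f : E N → ℝ} {x p v : E N} {M η₀ B η : ℝ}
    (hη₀ : 0 < η₀) (hM : 0 ≤ M) (h : HasC11Expansion f x p M η₀) (hB : ∀ z, |f z| ≤ B)
    (hv : ‖v‖ = 1) (hη : 0 < η) :
    |f (x + η • v) + f (x - η • v) - 2 * f x|
      ≤ (2 * M + 4 * B + 4 * B / η₀ ^ 2) * min (η ^ 2) 1 := by
  have hB0 : 0 ≤ B := (abs_nonneg _).trans (hB x)
  refine abs_le_mul_min_sq hη₀ (by linarith) (by linarith) (fun hlt => ?_)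
    (abs_second_diff_le_of_abs_le (hB _) (hB _) (hB _))
  have hn : ‖η • v‖ = η := by rw [norm_smul, hv, mul_one, Real.norm_of_nonneg hη.le]
  have h1 := h (η • v) (by rwa [hn])
  have h2 := h (-(η • v)) (by rwa [norm_neg, hn])
  rw [norm_neg, inner_neg_right, ← sub_eq_add_neg] at h2
  rw [hn, abs_le] at h1 h2
  rw [abs_le]
  constructor <;> linarith [h1.1, h1.2, h2.1, h2.2]

/-! ### Comparison and translation for the operator -/

theorem norm_inv_smul_self {p : E N} (hp : p ≠ 0) : ‖‖p‖⁻¹ • p‖ = 1 := by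
  rw [norm_smul, norm_inv, norm_norm, inv_mul_cancel₀ (norm_ne_zero_iff.2 hp)]

/-- A common slope `p` puts both functions in the same branch, with the same direction. The
expansions and the bounds make every integral converge absolutely, and bound the families over the
sphere, as real suprema and infima require. -/
theorem infFracLaplacian_mono {s : ℝ} (hs : 0 < s) (hs1 : s < 1) {f g : E N → ℝ} {x p : E N}
    {M M' η₀ η₁ B B' : ℝ} (hf : Measurable f) (hg : Measurable g) (hfB : ∀ z, |f z| ≤ B)
    (hgB : ∀ z, |g z| ≤ B') (hη₀ : 0 < η₀) (hη₁ : 0 < η₁) (hM : 0 ≤ M) (hM' : 0 ≤ M')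
    (hfx : HasC11Expansion f x p M η₀) (hgx : HasC11Expansion g x p M' η₁)
    (hle : ∀ z, f z ≤ g z) (heq : f x = g x) :
    infFracLaplacian s f x ≤ infFracLaplacian s g x := by
  unfold infFracLaplacian
  rw [(hfx.hasGradientAt hη₀).gradient, (hgx.hasGradientAt hη₁).gradient, heq]
  have hpos : ∀ η ∈ Ioi (0 : ℝ), 0 ≤ η ^ (1 + 2 * s) := fun η hη =>
    Real.rpow_nonneg (le_of_lt hη) _
  split_ifs with hp
  · have hv := norm_inv_smul_self hp
    set v := ‖p‖⁻¹ • p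
    refine setIntegral_mono_on ?_ ?_ measurableSet_Ioi fun η hη => ?_
    · rw [← heq]
      refine integrableOn_div_of_abs_le hs hs1 ?_ fun η hη =>
        hfx.abs_second_diff_le hη₀ hM hfB hv hη
      fun_prop
    · refine integrableOn_div_of_abs_le hs hs1 ?_ fun η hη =>
        hgx.abs_second_diff_le hη₁ hM' hgB hv hη
      fun_prop
    · refine div_le_div_of_nonneg_right ?_ (hpos η hη)
      linarith [hle (x + η • v), hle (x - η • v)]
  · rw [not_not] at hp
    subst hp
    have hsph : ∀ y : Metric.sphere (0 : E N) 1, ‖(y : E N)‖ = 1 := fun y => by simp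
    have hsph' : ∀ y : Metric.sphere (0 : E N) 1, ‖-(y : E N)‖ = 1 := fun y => by simp
    have hsub : ∀ (η : ℝ) (y : E N), x - η • y = x + η • (-y) := fun η y => by
      rw [smul_neg, sub_eq_add_neg]
    have hint : ∀ v : E N, ‖v‖ = 1 →
        ∫ η in Ioi (0 : ℝ), (f (x + η • v) - g x) / η ^ (1 + 2 * s)
          ≤ ∫ η in Ioi (0 : ℝ), (g (x + η • v) - g x) / η ^ (1 + 2 * s) := fun v hv => by
      refine setIntegral_mono_on ?_ ?_ measurableSet_Ioi fun η hη => ?_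
      · rw [← heq]
        refine integrableOn_div_of_abs_le hs hs1 ?_ fun η hη =>
          hfx.abs_sub_le hη₀ hM hfB hv hη
        fun_prop
      · refine integrableOn_div_of_abs_le hs hs1 ?_ fun η hη =>
          hgx.abs_sub_le hη₁ hM' hgB hv hη
        fun_prop
      · refine div_le_div_of_nonneg_right ?_ (hpos η hη)
        linarith [hle (x + η • v)]
    simp only [hsub]
    refine add_le_add (ciSup_mono ?_ fun y => hint y (hsph y))
      (ciInf_mono ?_ fun y => hint (-y) (hsph' y))
    · refine ⟨_, forall_mem_range.2 fun y => (le_abs_self _).trans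
        (abs_integral_div_le hs hs1 fun η hη => hgx.abs_sub_le hη₁ hM' hgB (hsph y) hη)⟩
    · rw [← heq]
      refine ⟨_, forall_mem_range.2 fun y => (abs_le.1
        (abs_integral_div_le hs hs1 fun η hη => hfx.abs_sub_le hη₀ hM hfB (hsph' y) hη)).1⟩

theorem infFracLaplacian_comp_add_sub (s : ℝ) (f : E N → ℝ) (h x : E N) (c : ℝ) :
    infFracLaplacian s (fun z => f (z + h) - c) x = infFracLaplacian s f (x + h) := by
  have hg : gradient (fun z => f (z + h) - c) x = gradient f (x + h) := by
    unfold gradient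
    rw [fderiv_sub_const, fderiv_comp_add_right]
  unfold infFracLaplacian
  simp only [hg]
  have e1 : ∀ y : E N, x + y + h = x + h + y := fun y => by abel
  have e2 : ∀ y : E N, x - y + h = x + h - y := fun y => by abel
  have e3 : ∀ a b d : ℝ, a - c + (b - c) - 2 * (d - c) = a + b - 2 * d := fun a b d => by ring
  simp only [e1, e2, e3, sub_sub_sub_cancel_right]

/-! ### Semiconcavity from local supporting paraboloids -/

/-- Local affine upper supports force concavity. If `G 1 > 0`, subtracting the chord gives a
function vanishing at both ends and negative somewhere, hence with an interior minimum. A support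
line there makes it constant nearby, which is impossible at the leftmost minimiser. -/
theorem le_zero_of_local_support {G : ℝ → ℝ} (hG : ContinuousOn G (Icc 0 1)) (h0 : G 0 = 0)
    (hnear : ∀ᶠ t in 𝓝 (0 : ℝ), G t ≤ 0)
    (hloc : ∀ t₀ : ℝ, ∃ q : ℝ, ∀ᶠ t in 𝓝 t₀, G t ≤ G t₀ + q * (t - t₀)) : G 1 ≤ 0 := by
  by_contra! hpos
  set H : ℝ → ℝ := fun t => G t - t * G 1 with hH
  have hHc : ContinuousOn H (Icc 0 1) := by fun_prop
  obtain ⟨t₀, ht₀, hmin⟩ := isCompact_Icc.exists_isMinOn (nonempty_Icc.2 zero_le_one) hHc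
  have hneg : H t₀ < 0 := by
    obtain ⟨ε, hε, hb⟩ := Metric.eventually_nhds_iff.1 hnear
    have h1 : 0 < min (ε / 2) 1 := by positivity
    have h2 : G (min (ε / 2) 1) ≤ 0 := hb (by
      rw [Real.dist_eq, sub_zero, abs_of_pos h1]
      linarith [min_le_left (ε / 2) 1])
    have h3 : H t₀ ≤ H (min (ε / 2) 1) := hmin ⟨h1.le, min_le_right _ _⟩
    have h4 := mul_pos h1 hpos
    simp only [hH] at h3 ⊢
    linarith
  obtain ⟨t₁, ⟨ht₁, heq⟩, hleast⟩ : ∃ t, IsLeast (Icc 0 1 ∩ H ⁻¹' {H t₀}) t :=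
    (isCompact_Icc.of_isClosed_subset
      (hHc.preimage_isClosed_of_isClosed isClosed_Icc isClosed_singleton)
      inter_subset_left).exists_isLeast ⟨t₀, ht₀, rfl⟩
  have heq' : H t₁ = H t₀ := heq
  have ht₁0 : 0 < t₁ := by
    refine lt_of_le_of_ne ht₁.1 fun h => ?_
    rw [← heq', ← h] at hneg
    simp [hH, h0] at hneg
  have ht₁1 : t₁ < 1 := by
    refine lt_of_le_of_ne ht₁.2 fun h => ?_
    rw [← heq', h] at hneg
    simp [hH] at hneg
  obtain ⟨q, hq⟩ := hloc t₁
  obtain ⟨ε, hε, hb⟩ := Metric.eventually_nhds_iff.1 hq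
  set τ : ℝ := min (ε / 2) (min t₁ (1 - t₁)) with hτ
  have hτ0 : 0 < τ := lt_min (by linarith) (lt_min ht₁0 (by linarith))
  have hτε : τ < ε := (min_le_left _ _).trans_lt (by linarith)
  have hτ1 : τ ≤ t₁ := (min_le_right _ _).trans (min_le_left _ _)
  have hτ2 : τ ≤ 1 - t₁ := (min_le_right _ _).trans (min_le_right _ _)
  have hL := hb (y := t₁ - τ) (by
    rw [Real.dist_eq, show t₁ - τ - t₁ = -τ by ring, abs_neg, abs_of_pos hτ0]; exact hτε)
  have hR := hb (y := t₁ + τ) (by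
    rw [Real.dist_eq, show t₁ + τ - t₁ = τ by ring, abs_of_pos hτ0]; exact hτε)
  have hmL : H t₀ ≤ H (t₁ - τ) := hmin ⟨by linarith, by linarith⟩
  have hmR : H t₀ ≤ H (t₁ + τ) := hmin ⟨by linarith, by linarith⟩
  have hLm : t₁ - τ ∈ Icc (0 : ℝ) 1 ∩ H ⁻¹' {H t₀} := by
    refine ⟨⟨by linarith, by linarith⟩, le_antisymm ?_ hmL⟩
    rw [← heq'] at hmL hmR ⊢
    simp only [hH] at hmL hmR ⊢
    nlinarith
  linarith [hleast hLm]

/-- `f` is touched from above at `x` by the paraboloid of slope `p` and opening `M`, locally. -/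
def LocalUpperSupport (f : E N → ℝ) (M : ℝ) (x p : E N) : Prop :=
  ∃ η₀ : ℝ, 0 < η₀ ∧ ∀ h : E N, ‖h‖ < η₀ → f (x + h) ≤ f x + inner ℝ p h + M * ‖h‖ ^ 2

/-- Along the segment from `x` to `x + h`, subtracting `M * t ^ 2 * ‖h‖ ^ 2` turns the supporting
paraboloids into supporting lines, and the one-dimensional lemma applies. -/
theorem LocalUpperSupport.global {f : E N → ℝ} {M : ℝ} (hf : Continuous f)
    (hsup : ∀ x, ∃ p, LocalUpperSupport f M x p) {x p : E N} (hp : LocalUpperSupport f M x p)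
    (h : E N) : f (x + h) ≤ f x + inner ℝ p h + M * ‖h‖ ^ 2 := by
  set G : ℝ → ℝ := fun t => f (x + t • h) - f x - t * inner ℝ p h - M * t ^ 2 * ‖h‖ ^ 2 with hG
  have hsmall : ∀ (t₀ η₀ : ℝ), 0 < η₀ → ∀ᶠ t in 𝓝 t₀, ‖(t - t₀) • h‖ < η₀ := fun t₀ η₀ hη => by
    have hc : Continuous fun t : ℝ => ‖(t - t₀) • h‖ := by fun_prop
    refine hc.continuousAt.eventually_lt continuousAt_const ?_
    simpa using hη
  have key : G 1 ≤ 0 := by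
    refine le_zero_of_local_support (by fun_prop) (by simp [hG]) ?_ fun t₀ => ?_
    · obtain ⟨η₀, hη, hb⟩ := hp
      filter_upwards [hsmall 0 η₀ hη] with t ht
      rw [sub_zero] at ht
      have h1 := hb (t • h) ht
      rw [inner_smul_right, norm_smul, mul_pow, Real.norm_eq_abs, sq_abs] at h1
      simp only [hG]
      linarith
    · obtain ⟨p', η₀, hη, hb⟩ := hsup (x + t₀ • h)
      refine ⟨inner ℝ p' h - inner ℝ p h - 2 * M * t₀ * ‖h‖ ^ 2, ?_⟩
      filter_upwards [hsmall t₀ η₀ hη] with t ht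
      have h1 := hb ((t - t₀) • h) ht
      rw [add_assoc, ← add_smul, add_sub_cancel, inner_smul_right, norm_smul, mul_pow,
        Real.norm_eq_abs, sq_abs] at h1
      simp only [hG]
      linarith
  simp only [hG, one_smul] at key
  linarith

/-- Outside `{f < c}` the function attains its maximum `c`, so slope `0` supports it and its
gradient vanishes. A nonzero gradient therefore places the point where the expansion is available.
-/
theorem UniformlyC11Inside.exists_upper_support {f : E N → ℝ} {c : ℝ}
    (h : UniformlyC11Inside f {x | f x < c}) (hc : ∀ x, f x ≤ c) :
    ∃ M : ℝ, 0 < M ∧ (∀ x, ∃ p, LocalUpperSupport f M x p) ∧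
      ∀ x, gradient f x ≠ 0 → LocalUpperSupport f M x (gradient f x) := by
  obtain ⟨M, hM, hex⟩ := h
  have hin : ∀ x, f x < c → LocalUpperSupport f M x (gradient f x) := fun x hx => by
    obtain ⟨p, η₀, hη, hexp⟩ := hex x hx
    rw [(hexp.hasGradientAt hη).gradient]
    refine ⟨η₀, hη, fun k hk => ?_⟩
    have := (abs_le.1 (hexp k hk)).2
    linarith
  refine ⟨M, hM, fun x => ?_, fun x hx => ?_⟩
  · rcases (hc x).lt_or_eq with hx | hx
    · exact ⟨_, hin x hx⟩
    · refine ⟨0, 1, one_pos, fun k _ => ?_⟩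
      rw [inner_zero_left, hx]
      have : 0 ≤ M * ‖k‖ ^ 2 := by positivity
      linarith [hc (x + k)]
  · refine hin x (lt_of_le_of_ne (hc x) fun heq => hx ?_)
    have hmax : IsLocalMax f x := Eventually.of_forall fun z => (hc z).trans_eq heq.symm
    simp [gradient, hmax.fderiv_eq_zero]

theorem UniformlyC11Inside.neg {f : E N → ℝ} (h : UniformlyC11Inside f {x | 0 < f x}) :
    UniformlyC11Inside (-f) {x | (-f) x < 0} := by
  obtain ⟨M, hM, hex⟩ := h
  refine ⟨M, hM, fun x hx => ?_⟩
  obtain ⟨p, η₀, hη, hexp⟩ := hex x (by simpa using hx)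
  refine ⟨-p, η₀, hη, fun k hk => ?_⟩
  rw [← abs_neg]
  convert hexp k hk using 2
  simp only [Pi.neg_apply, inner_neg_left]
  ring

theorem gradient_neg (f : E N → ℝ) (x : E N) : gradient (-f) x = -gradient f x := by
  simp [gradient, fderiv_neg]

/-! ### Subsolutions and admissible functions -/

theorem cutIn_of_mem {u φ : E N → ℝ} {x₀ x : E N} {r : ℝ} (h : x ∈ Metric.ball x₀ r) :
    cutIn u φ x₀ r x = φ x := if_pos h

theorem cutIn_of_notMem {u φ : E N → ℝ} {x₀ x : E N} {r : ℝ} (h : x ∉ Metric.ball x₀ r) :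
    cutIn u φ x₀ r x = u x := if_neg h

theorem cutIn_self {u φ : E N → ℝ} {x₀ : E N} {r : ℝ} (hr : 0 < r) :
    cutIn u φ x₀ r x₀ = φ x₀ := cutIn_of_mem (Metric.mem_ball_self hr)

theorem measurable_cutIn {u φ : E N → ℝ} {x₀ : E N} {r : ℝ} (hu : Measurable u)
    (hφ : ContinuousOn φ (Metric.closedBall x₀ r)) : Measurable (cutIn u φ x₀ r) := by
  refine measurable_of_restrict_of_restrict_compl (s := Metric.ball x₀ r) measurableSet_ball ?_ ?_
  · have h1 : (Metric.ball x₀ r).domRestrict (cutIn u φ x₀ r) = (Metric.ball x₀ r).domRestrict φ := by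
      ext ⟨z, hz⟩
      exact cutIn_of_mem hz
    rw [h1]
    exact (hφ.mono Metric.ball_subset_closedBall).domRestrict.measurable
  · have h1 : (Metric.ball x₀ r)ᶜ.domRestrict (cutIn u φ x₀ r) = (Metric.ball x₀ r)ᶜ.domRestrict u := by
      ext ⟨z, hz⟩
      exact cutIn_of_notMem hz
    rw [h1]
    exact hu.comp measurable_subtype_coe

theorem exists_abs_cutIn_le {u φ : E N → ℝ} {x₀ : E N} {r B : ℝ} (hu : ∀ z, |u z| ≤ B)
    (hφ : ContinuousOn φ (Metric.closedBall x₀ r)) : ∃ B', ∀ z, |cutIn u φ x₀ r z| ≤ B' := by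
  obtain ⟨K, hK⟩ := (isCompact_closedBall x₀ r).exists_bound_of_continuousOn hφ
  refine ⟨max K B, fun z => ?_⟩
  by_cases hz : z ∈ Metric.ball x₀ r
  · rw [cutIn_of_mem hz]
    exact (hK z (Metric.ball_subset_closedBall hz)).trans (le_max_left _ _)
  · rw [cutIn_of_notMem hz]
    exact (hu z).trans (le_max_right _ _)

/-- The subsolution property at a point passes to larger functions with the same value there. -/
theorem IsSubsolutionAt.of_le {s : ℝ} (hs : 0 < s) (hs1 : s < 1) {u w : E N → ℝ} {x₀ : E N}
    {B B' : ℝ} (hw : IsSubsolutionAt s w x₀) (hu : UpperSemicontinuous u) (hwB : ∀ z, |w z| ≤ B)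
    (huB : ∀ z, |u z| ≤ B') (hle : ∀ z, w z ≤ u z) (heq : w x₀ = u x₀) :
    IsSubsolutionAt s u x₀ := by
  refine ⟨hu, fun r φ hr hφ hc h0 hlt => ?_⟩
  refine (hw.2 r φ hr hφ hc (h0.trans heq.symm) fun x hx => (hle x).trans_lt (hlt x hx)).trans ?_
  obtain ⟨p, M, η₀, hM, hη, hexp⟩ := hφ
  obtain ⟨K, hK⟩ := exists_abs_cutIn_le hwB hc
  obtain ⟨K', hK'⟩ := exists_abs_cutIn_le huB hc
  refine infFracLaplacian_mono hs hs1 (measurable_cutIn hw.1.measurable hc)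
    (measurable_cutIn hu.measurable hc) hK hK' (lt_min hη hr) (lt_min hη hr) hM.le hM.le
    (hexp.cutIn hr) (hexp.cutIn hr) (fun z => ?_) (by rw [cutIn_self hr, cutIn_self hr])
  by_cases hz : z ∈ Metric.ball x₀ r
  · rw [cutIn_of_mem hz, cutIn_of_mem hz]
  · rw [cutIn_of_notMem hz, cutIn_of_notMem hz]
    exact hle z

theorem IsSubsolutionAt.comp_add_sub {s : ℝ} {u : E N → ℝ} {x₀ h : E N} (c : ℝ)
    (hu : IsSubsolutionAt s u (x₀ + h)) : IsSubsolutionAt s (fun z => u (z + h) - c) x₀ := by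
  refine ⟨?_, fun r φ hr hφ hc h0 hlt => ?_⟩
  · have h1 : UpperSemicontinuous fun z => u (z + h) := hu.1.comp (continuous_add_const h)
    simpa [sub_eq_add_neg] using h1.add (upperSemicontinuous_const (z := -c))
  · have hmem : ∀ z, z - h ∈ Metric.closedBall x₀ r ↔ z ∈ Metric.closedBall (x₀ + h) r := fun z => by
      simp only [Metric.mem_closedBall, dist_eq_norm]
      rw [sub_sub, add_comm h]
    have hmem' : ∀ z, z + h ∈ Metric.ball (x₀ + h) r ↔ z ∈ Metric.ball x₀ r := fun z => by
      simp [Metric.mem_ball]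
    have key := hu.2 r (fun z => φ (z - h) + c) hr ?_ ?_ (by simp [h0]) ?_
    · rw [← infFracLaplacian_comp_add_sub s _ h x₀ c] at key
      convert key using 2
      ext z
      simp [cutIn, apply_ite (· - c)]
    · obtain ⟨p, M, η₀, hM, hη, hexp⟩ := hφ
      refine ⟨p, M, η₀, hM, hη, fun k hk => ?_⟩
      have := hexp k hk
      beta_reduce
      rwa [show x₀ + h + k - h = x₀ + k by abel, add_sub_cancel_right, add_sub_add_right_eq_sub]
    · refine ContinuousOn.add (hc.comp (by fun_prop) fun z hz => (hmem z).2 hz) continuousOn_const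
    · rintro z ⟨hz, hne⟩
      have h1 := hlt (z - h) ⟨(hmem' _).1 (by simpa using hz), fun h2 => hne ?_⟩
      · simp only [sub_add_cancel] at h1
        linarith
      · rw [mem_singleton_iff] at h2 ⊢
        rw [← h2, sub_add_cancel]

/-! ### Admissible functions between the obstacles and the Lipschitz bound -/

section Obstacles

variable {s θ L₀ : ℝ} {Γp Γm : E N → ℝ}

/-- Semicontinuity is part of being a subsolution at a point, so it is available once `u` exceeds
`Γm` somewhere; otherwise `u` is `Γm`. -/
theorem upperSemicontinuous_of_mem_admissible (hm : Continuous Γm) {u : E N → ℝ}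
    (hu : u ∈ admissible s Γp Γm) : UpperSemicontinuous u := by
  by_cases h : ∃ x, Γm x < u x
  · obtain ⟨x, hx⟩ := h
    exact (hu.1 x hx).1
  · push Not at h
    have : u = Γm := funext fun x => le_antisymm (h x) (hu.2.1 x)
    rw [this]
    exact hm.upperSemicontinuous

theorem le_obstacleSolution {u : E N → ℝ} (hu : u ∈ admissible s Γp Γm) (x : E N) :
    u x ≤ obstacleSolution s Γp Γm x :=
  le_csSup ⟨Γp x, forall_mem_image.2 fun _ hv => hv.2.2 x⟩ (mem_image_of_mem _ hu)

variable [NeZero N]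

theorem ObstacleAssumptions.continuous_upper (H : ObstacleAssumptions s θ L₀ Γp Γm) :
    Continuous Γp :=
  (LipschitzWith.of_dist_le' (K := L₀) fun x y => by
    simpa [dist_eq_norm] using H.upper_lipschitz x y).continuous

theorem ObstacleAssumptions.continuous_lower (H : ObstacleAssumptions s θ L₀ Γp Γm) :
    Continuous Γm :=
  (LipschitzWith.of_dist_le' (K := L₀) fun x y => by
    simpa [dist_eq_norm] using H.lower_lipschitz x y).continuous

theorem ObstacleAssumptions.abs_le_one (H : ObstacleAssumptions s θ L₀ Γp Γm) {u : E N → ℝ}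
    (h1 : ∀ x, Γm x ≤ u x) (h2 : ∀ x, u x ≤ Γp x) (x : E N) : |u x| ≤ 1 := by
  rw [abs_le]
  constructor <;> linarith [h1 x, h2 x, H.lower_nonneg x, H.upper_le_one x]

/-- A function between the obstacles which, wherever it exceeds `Γm`, is touched from below by a
bounded subsolution is admissible. -/
theorem ObstacleAssumptions.mem_admissible_of_touching (H : ObstacleAssumptions s θ L₀ Γp Γm)
    (hs : 0 < s) (hs1 : s < 1) {u : E N → ℝ} (hu : UpperSemicontinuous u)
    (hm : ∀ x, Γm x ≤ u x) (hp : ∀ x, u x ≤ Γp x)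
    (h : ∀ z, Γm z < u z → ∃ (w : E N → ℝ) (B : ℝ), IsSubsolutionAt s w z ∧ (∀ x, |w x| ≤ B) ∧
      (∀ x, w x ≤ u x) ∧ w z = u z) : u ∈ admissible s Γp Γm := by
  refine ⟨fun z hz => ?_, hm, hp⟩
  obtain ⟨w, B, hw, hB, hle, heq⟩ := h z hz
  exact hw.of_le hs hs1 hu hB (H.abs_le_one hm hp) hle heq

/-- The translates of an admissible function lowered by the Lipschitz bound of the obstacles. -/
theorem ObstacleAssumptions.translate (H : ObstacleAssumptions s θ L₀ Γp Γm) {L : ℝ} (hL : L₀ ≤ L)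
    {u : E N → ℝ} (hu : u ∈ admissible s Γp Γm) (h : E N) :
    (∀ z, u (z + h) - L * ‖h‖ ≤ Γp z) ∧ (∀ z, |u (z + h) - L * ‖h‖| ≤ 1 + |L * ‖h‖|) ∧
      ∀ z, Γm z < u (z + h) - L * ‖h‖ →
        IsSubsolutionAt s (fun z => u (z + h) - L * ‖h‖) z := by
  have hLh : L₀ * ‖h‖ ≤ L * ‖h‖ := mul_le_mul_of_nonneg_right hL (norm_nonneg _)
  refine ⟨fun z => ?_, fun z => ?_, fun z hz => ?_⟩
  · have h1 := (abs_le.1 (H.upper_lipschitz (z + h) z)).2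
    rw [add_sub_cancel_left] at h1
    linarith [hu.2.2 (z + h)]
  · exact (abs_sub _ _).trans (by linarith [H.abs_le_one hu.2.1 hu.2.2 (z + h)])
  · have h1 := (abs_le.1 (H.lower_lipschitz (z + h) z)).2
    rw [add_sub_cancel_left] at h1
    exact (hu.1 (z + h) (by linarith)).comp_add_sub _

theorem ObstacleAssumptions.lower_mem_admissible (H : ObstacleAssumptions s θ L₀ Γp Γm) :
    Γm ∈ admissible s Γp Γm :=
  ⟨fun _ hx => absurd hx (lt_irrefl _), fun _ => le_rfl, fun x => (H.lower_lt_upper x).le⟩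

theorem ObstacleAssumptions.obstacleSolution_le_of_forall (H : ObstacleAssumptions s θ L₀ Γp Γm)
    {x : E N} {c : ℝ} (h : ∀ u ∈ admissible s Γp Γm, u x ≤ c) : obstacleSolution s Γp Γm x ≤ c :=
  csSup_le (Nonempty.image _ ⟨Γm, H.lower_mem_admissible⟩) (forall_mem_image.2 h)

theorem ObstacleAssumptions.exists_lt_of_lt_obstacleSolution
    (H : ObstacleAssumptions s θ L₀ Γp Γm) {x : E N} {c : ℝ}
    (h : c < obstacleSolution s Γp Γm x) : ∃ u ∈ admissible s Γp Γm, c < u x := by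
  by_contra! hc
  exact absurd h (not_lt.2 (H.obstacleSolution_le_of_forall hc))

theorem ObstacleAssumptions.obstacleSolution_le (H : ObstacleAssumptions s θ L₀ Γp Γm) (x : E N) :
    obstacleSolution s Γp Γm x ≤ Γp x :=
  H.obstacleSolution_le_of_forall fun _ hu => hu.2.2 x

theorem ObstacleAssumptions.le_obstacleSolution_lower (H : ObstacleAssumptions s θ L₀ Γp Γm)
    (x : E N) : Γm x ≤ obstacleSolution s Γp Γm x :=
  le_obstacleSolution H.lower_mem_admissible x

theorem ObstacleAssumptions.obstacleSolution_lipschitz (H : ObstacleAssumptions s θ L₀ Γp Γm)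
    (hs : 0 < s) (hs1 : s < 1) (x z : E N) :
    |obstacleSolution s Γp Γm x - obstacleSolution s Γp Γm z| ≤ L₀ * ‖x - z‖ := by
  have key : ∀ x z : E N, obstacleSolution s Γp Γm x - L₀ * ‖x - z‖ ≤ obstacleSolution s Γp Γm z := by
    intro x z
    rw [sub_le_iff_le_add]
    refine H.obstacleSolution_le_of_forall fun u hu => ?_
    obtain ⟨hup, huB, husub⟩ := H.translate le_rfl hu (x - z)
    set w : E N → ℝ := fun y => u (y + (x - z)) - L₀ * ‖x - z‖ with hw
    have husc : UpperSemicontinuous w := by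
      have h1 : UpperSemicontinuous fun y => u (y + (x - z)) :=
        (upperSemicontinuous_of_mem_admissible H.continuous_lower hu).comp (continuous_add_const _)
      simpa [hw, sub_eq_add_neg] using
        h1.add (upperSemicontinuous_const (z := -(L₀ * ‖x - z‖)))
    have hadm : (fun y => max (w y) (Γm y)) ∈ admissible s Γp Γm := by
      refine H.mem_admissible_of_touching hs hs1
        (husc.sup H.continuous_lower.upperSemicontinuous) (fun y => le_max_right _ _)
        (fun y => max_le (hup y) (H.lower_lt_upper y).le) fun y hy => ?_
      have h1 : Γm y < w y := by simpa using hy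
      exact ⟨w, _, husub y h1, huB, fun _ => le_max_left _ _, (max_eq_left h1.le).symm⟩
    have h2 := (le_max_left _ _).trans (le_obstacleSolution hadm z)
    simp only [hw, add_sub_cancel] at h2
    linarith
  rw [abs_le]
  have h1 := key x z
  have h2 := key z x
  rw [norm_sub_rev] at h2
  constructor <;> linarith

/-- Every admissible function lies below a Lipschitz one, its sup-convolution. -/
theorem ObstacleAssumptions.exists_lipschitz_admissible (H : ObstacleAssumptions s θ L₀ Γp Γm)
    (hs : 0 < s) (hs1 : s < 1) {L : ℝ} (hL : L₀ ≤ L) (hL0 : 0 < L) {u : E N → ℝ}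
    (hu : u ∈ admissible s Γp Γm) :
    ∃ w ∈ admissible s Γp Γm, (∀ x, u x ≤ w x) ∧ ∀ x z, w x ≤ w z + L * ‖x - z‖ := by
  have husc := upperSemicontinuous_of_mem_admissible H.continuous_lower hu
  have huB := H.abs_le_one hu.2.1 hu.2.2
  -- Since `|u| ≤ 1`, beyond radius `2 / L` the penalty outweighs any gain in `u`, so the supremum
  -- is attained on a compact ball.
  have hatt : ∀ z, ∃ h₀ : E N, ∀ h, u (z + h) - L * ‖h‖ ≤ u (z + h₀) - L * ‖h₀‖ := by
    intro z
    have h1 : UpperSemicontinuous fun h : E N => u (z + h) - L * ‖h‖ := by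
      have h2 : UpperSemicontinuous fun h : E N => u (z + h) := husc.comp (continuous_const_add z)
      have h3 : Continuous fun h : E N => -(L * ‖h‖) := by fun_prop
      simpa [sub_eq_add_neg] using h2.add h3.upperSemicontinuous
    obtain ⟨h₀, _, hmax⟩ := (h1.upperSemicontinuousOn (Metric.closedBall 0 (2 / L))).exists_isMaxOn
      ⟨0, Metric.mem_closedBall_self (by positivity)⟩ (isCompact_closedBall 0 (2 / L))
    refine ⟨h₀, fun h => ?_⟩
    by_cases hh : h ∈ Metric.closedBall (0 : E N) (2 / L)
    · exact hmax hh
    · have h4 : u (z + 0) - L * ‖(0 : E N)‖ ≤ u (z + h₀) - L * ‖h₀‖ :=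
        hmax (Metric.mem_closedBall_self (by positivity))
      rw [mem_closedBall_zero_iff, not_le, div_lt_iff₀ hL0] at hh
      rw [norm_zero] at h4
      have h5 := (abs_le.1 (huB (z + h))).2
      have h6 := (abs_le.1 (huB (z + 0))).1
      linarith
  choose k hk using hatt
  set w : E N → ℝ := fun z => u (z + k z) - L * ‖k z‖ with hw
  have hge : ∀ z h, u (z + h) - L * ‖h‖ ≤ w z := hk
  have hlip : ∀ x z, w x ≤ w z + L * ‖x - z‖ := fun x z => by
    have h1 := hge z (x - z + k x)
    rw [← add_assoc, add_sub_cancel] at h1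
    have h2 := mul_le_mul_of_nonneg_left (norm_add_le (x - z) (k x)) hL0.le
    simp only [hw] at h1 ⊢
    linarith
  have huw : ∀ x, u x ≤ w x := fun x => by simpa using hge x 0
  have hcont : Continuous w := by
    refine (LipschitzWith.of_dist_le' (K := L) fun x z => ?_).continuous
    rw [Real.dist_eq, dist_eq_norm, abs_le]
    have h1 := hlip x z
    have h2 := hlip z x
    rw [norm_sub_rev] at h2
    constructor <;> linarith
  refine ⟨w, H.mem_admissible_of_touching hs hs1 hcont.upperSemicontinuous
    (fun x => (hu.2.1 x).trans (huw x)) (fun z => (H.translate hL hu (k z)).1 z) fun z hz => ?_,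
    huw, hlip⟩
  obtain ⟨-, hB, hsub⟩ := H.translate hL hu (k z)
  -- The translate by the maximiser `k z` touches `w` from below at `z`.
  exact ⟨_, _, hsub z hz, hB, fun x => hge x (k z), rfl⟩

end Obstacles

/-! ### Contact estimates -/

theorem norm_add_smul_sub_add_smul_le {x z v y : E N} {η r : ℝ} (hv : ‖v‖ = 1) (hr : 0 ≤ r) :
    ‖z + η • v - (x + r • y)‖ ≤ ‖z - x‖ + |η - r| + r * ‖v - y‖ := by
  have h1 : z + η • v - (x + r • y) = (z - x) + (η - r) • v + r • (v - y) := by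
    rw [sub_smul, smul_sub]
    abel
  rw [h1]
  refine (norm_add₃_le).trans (le_of_eq ?_)
  rw [norm_smul, norm_smul, hv, mul_one, Real.norm_eq_abs, Real.norm_of_nonneg hr]

/-- The direction of an affine field does not vary much near a point where it does not vanish. -/
theorem exists_radius_direction {p : E N} (hp : p ≠ 0) (x : E N) (κ L r : ℝ) {e : ℝ} (he : 0 < e) :
    ∃ σ : ℝ, 0 < σ ∧ ∀ z : E N, ‖z - x‖ < σ → p + κ • (z - x) ≠ 0 ∧
      L * (‖z - x‖ + r * ‖‖p + κ • (z - x)‖⁻¹ • (p + κ • (z - x)) - ‖p‖⁻¹ • p‖) < e := by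
  have hP : Continuous fun z : E N => p + κ • (z - x) := by fun_prop
  have h1 : ∀ᶠ z in 𝓝 x, p + κ • (z - x) ≠ 0 := by
    refine hP.continuousAt.eventually_ne ?_
    simpa using hp
  have h2 : ContinuousAt (fun z : E N =>
      L * (‖z - x‖ + r * ‖‖p + κ • (z - x)‖⁻¹ • (p + κ • (z - x)) - ‖p‖⁻¹ • p‖)) x := by
    have h3 : ContinuousAt (fun z : E N => ‖p + κ • (z - x)‖⁻¹) x := by
      refine hP.norm.continuousAt.inv₀ ?_
      simpa using hp
    have h4 := (h3.smul hP.continuousAt).sub (continuousAt_const (y := ‖p‖⁻¹ • p))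
    have h5 : ContinuousAt (fun z : E N => ‖z - x‖) x := by fun_prop
    exact continuousAt_const.mul (h5.add (continuousAt_const.mul h4.norm))
  have h3 := h2.eventually_lt (continuousAt_const (y := e)) (by simpa using he)
  obtain ⟨σ, hσ, hb⟩ := Metric.eventually_nhds_iff.1 (h1.and h3)
  exact ⟨σ, hσ, fun z hz => hb (by rwa [dist_eq_norm])⟩

theorem paraboloid_hasC11Expansion (c M : ℝ) (hM : 0 ≤ M) (z₀ p : E N) :
    HasC11Expansion (fun z => c + inner ℝ p (z - z₀) + M * ‖z - z₀‖ ^ 2) z₀ p M 1 := by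
  intro h _
  simp only [add_sub_cancel_left, sub_self, inner_zero_right, norm_zero]
  rw [show c + inner ℝ p h + M * ‖h‖ ^ 2 - (c + 0 + M * 0 ^ 2) - inner ℝ p h = M * ‖h‖ ^ 2 by ring,
    abs_of_nonneg (by positivity)]

theorem norm_add_sq_expand (a b : E N) (M : ℝ) :
    M * ‖a + b‖ ^ 2 = M * ‖a‖ ^ 2 + inner ℝ ((2 * M) • a) b + M * ‖b‖ ^ 2 := by
  rw [norm_add_sq_real, real_inner_smul_left]
  ring

theorem second_diff_le_of_support {f : E N → ℝ} {M : ℝ} (hf : Continuous f)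
    (hsup : ∀ x, ∃ p, LocalUpperSupport f M x p) {x v : E N} (hv : ‖v‖ = 1) (η : ℝ) :
    f (x + η • v) + f (x - η • v) - 2 * f x ≤ 2 * M * η ^ 2 := by
  obtain ⟨p, hp⟩ := hsup x
  have h1 := hp.global hf hsup (η • v)
  have h2 := hp.global hf hsup (-(η • v))
  rw [norm_neg, inner_neg_right, ← sub_eq_add_neg] at h2
  rw [norm_smul, hv, mul_one, Real.norm_eq_abs, sq_abs] at h1 h2
  linarith

theorem infFracLaplacian_eq_integral {s : ℝ} {f : E N → ℝ} {x p : E N} (h : HasGradientAt f p x)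
    (hp : p ≠ 0) : infFracLaplacian s f x = ∫ η in Ioi (0 : ℝ),
      (f (x + η • (‖p‖⁻¹ • p)) + f (x - η • (‖p‖⁻¹ • p)) - 2 * f x) / η ^ (1 + 2 * s) := by
  unfold infFracLaplacian
  rw [h.gradient, if_pos hp]

/-! ### Contact with the upper obstacle -/

section Contact

variable [NeZero N] {s θ L₀ M L : ℝ} {Γp Γm : E N → ℝ}

theorem ObstacleAssumptions.abs_upper_sub_obstacleSolution_sub_le
    (H : ObstacleAssumptions s θ L₀ Γp Γm) (hs : 0 < s) (hs1 : s < 1) (hL : L₀ ≤ L) (a b : E N) :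
    (Γp a - obstacleSolution s Γp Γm a) - 2 * L * ‖b - a‖ ≤ Γp b - obstacleSolution s Γp Γm b := by
  have h1 := (abs_le.1 (H.upper_lipschitz b a)).1
  have h2 := (abs_le.1 (H.obstacleSolution_lipschitz hs hs1 b a)).2
  have h3 := mul_le_mul_of_nonneg_right hL (norm_nonneg (b - a))
  linarith

theorem ObstacleAssumptions.exists_radius_gap (H : ObstacleAssumptions s θ L₀ Γp Γm) (x : E N) :
    ∃ σ > 0, ∀ z, ‖z - x‖ < σ → (Γp x - Γm x) / 2 < Γp z - Γm z := by
  have hc : Continuous fun z => Γp z - Γm z := H.continuous_upper.sub H.continuous_lower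
  have h1 := (continuousAt_const (y := (Γp x - Γm x) / 2)).eventually_lt (hc.continuousAt (x := x))
    (by linarith [H.lower_lt_upper x])
  obtain ⟨σ, hσ, hb⟩ := Metric.eventually_nhds_iff.1 h1
  exact ⟨σ, hσ, fun z hz => hb (by rwa [dist_eq_norm])⟩

set_option maxHeartbeats 800000 in
-- An admissible `u` nearly equal to `U` at `x` is nearly touched from above by the paraboloid
-- tangent to `Γp`. The subsolution test at the touching point bounds the deficit `Γp - U` ahead of
-- it.
theorem ObstacleAssumptions.upper_contact (H : ObstacleAssumptions s θ L₀ Γp Γm) (hs : 0 < s)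
    (hs1 : s < 1) (hM : 0 ≤ M) (hL : L₀ ≤ L) (hL0 : 0 < L)
    (hsup : ∀ x, ∃ p, LocalUpperSupport Γp M x p) {x p : E N} (hp : LocalUpperSupport Γp M x p)
    (hp0 : p ≠ 0) (hx : Γp x = obstacleSolution s Γp Γm x) {r : ℝ} (hr : 0 < r) (hr1 : r < 1 / 2) :
    (Γp (x + r • (‖p‖⁻¹ • p)) - obstacleSolution s Γp Γm (x + r • (‖p‖⁻¹ • p))) ^ 2
      ≤ 16 * L * (2 * (M + 2) * (∫ η in Ioi (0 : ℝ), min (η ^ 2) 1 / η ^ (1 + 2 * s))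
        * (2 * r) ^ (1 + 2 * s)) := by
  have hK := integral_weight_nonneg s
  have hUp := H.obstacleSolution_le
  have hWlip := H.abs_upper_sub_obstacleSolution_sub_le hs hs1 hL
  have hΓp := H.continuous_upper
  set U := obstacleSolution s Γp Γm
  have hy := norm_inv_smul_self hp0
  set y := ‖p‖⁻¹ • p with hydef
  set δ := Γp (x + r • y) - U (x + r • y) with hδ
  rcases (show 0 ≤ δ from sub_nonneg.2 (hUp _)).eq_or_lt with h0 | hδ0
  · rw [← h0, zero_pow two_ne_zero]
    have := Real.rpow_nonneg (show 0 ≤ 2 * r by linarith) (1 + 2 * s)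
    exact mul_nonneg (by linarith) (mul_nonneg (mul_nonneg (by linarith) hK) this)
  have hδr : δ ≤ 2 * L * r := by
    have h1 := hWlip (x + r • y) x
    rw [sub_add_cancel_left, norm_neg, norm_smul, hy, Real.norm_of_nonneg hr.le, ← hx] at h1
    linarith
  obtain ⟨σ, hσ, hdir⟩ := exists_radius_direction hp0 x (2 * (M + 1)) (2 * L) r
    (show 0 < δ / 4 by positivity)
  obtain ⟨σ', hσ', hgap⟩ := H.exists_radius_gap x
  -- The touching point will satisfy `‖z₀ - x‖ ^ 2 < τ`. Thus `σ` controls the direction there, `σ'`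
  -- and the last entry give `Γm z₀ < u z₀`, and `r ^ 2` lets `τ` be absorbed in `min (η ^ 2) 1`.
  set τ := min (min (σ ^ 2) (σ' ^ 2)) (min (r ^ 2) ((Γp x - Γm x) / 2)) with hτ
  have hτ0 : 0 < τ := by
    have := H.lower_lt_upper x
    have h2 : 0 < (Γp x - Γm x) / 2 := by linarith
    positivity
  have hτσ : τ ≤ σ ^ 2 := (min_le_left _ _).trans (min_le_left _ _)
  have hτσ' : τ ≤ σ' ^ 2 := (min_le_left _ _).trans (min_le_right _ _)
  have hτr : τ ≤ r ^ 2 := (min_le_right _ _).trans (min_le_left _ _)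
  have hτg : τ ≤ (Γp x - Γm x) / 2 := (min_le_right _ _).trans (min_le_right _ _)
  obtain ⟨u, hu, hux⟩ := H.exists_lt_of_lt_obstacleSolution (show U x - τ < U x by linarith)
  have husc := upperSemicontinuous_of_mem_admissible H.continuous_lower hu
  -- Opening `M + 1` instead of `M` leaves the margin `‖z - x‖ ^ 2`, which localises the maximum of
  -- `u - q`.
  set q : E N → ℝ := fun z => Γp x + inner ℝ p (z - x) + (M + 1) * ‖z - x‖ ^ 2 with hq
  have hΓq : ∀ z, Γp z ≤ q z - ‖z - x‖ ^ 2 := fun z => by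
    have := hp.global hΓp hsup (z - x)
    rw [add_sub_cancel] at this
    simp only [hq]
    linarith
  obtain ⟨z₀, hz₀, hmax⟩ : ∃ z₀ ∈ Metric.closedBall x 1,
      IsMaxOn (fun z => u z - q z) (Metric.closedBall x 1) z₀ := by
    have h1 : Continuous fun z => -q z := by fun_prop
    have h2 := husc.add h1.upperSemicontinuous
    simp only [← sub_eq_add_neg] at h2
    exact (h2.upperSemicontinuousOn _).exists_isMaxOn
      ⟨x, Metric.mem_closedBall_self zero_le_one⟩ (isCompact_closedBall x 1)
  have hqx : q x = Γp x := by simp [hq]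
  have hz₀q : q z₀ - τ < u z₀ := by
    have h1 : u x - q x ≤ u z₀ - q z₀ := hmax (Metric.mem_closedBall_self zero_le_one)
    linarith
  have hz₀x : ‖z₀ - x‖ ^ 2 < τ := by linarith [hu.2.2 z₀, hΓq z₀]
  have hz₀Γ : Γp z₀ - τ < u z₀ := by linarith [hΓq z₀, sq_nonneg ‖z₀ - x‖]
  obtain ⟨hp'0, hdist⟩ := hdir z₀ (lt_of_pow_lt_pow_left₀ 2 hσ.le (hz₀x.trans_le hτσ))
  have hgap₀ := hgap z₀ (lt_of_pow_lt_pow_left₀ 2 hσ'.le (hz₀x.trans_le hτσ'))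
  have hz₀r : ‖z₀ - x‖ < r := lt_of_pow_lt_pow_left₀ 2 hr.le (hz₀x.trans_le hτr)
  have hv := norm_inv_smul_self hp'0
  set p' := p + (2 * (M + 1)) • (z₀ - x) with hp'
  set v := ‖p'‖⁻¹ • p' with hvdef
  -- This is `q` translated vertically and recentred at `z₀`, with one more unit of opening to make
  -- the touching strict.
  set φ : E N → ℝ := fun z => u z₀ + inner ℝ p' (z - z₀) + (M + 2) * ‖z - z₀‖ ^ 2 with hφ
  have hφexp : HasC11Expansion φ z₀ p' (M + 2) 1 :=
    paraboloid_hasC11Expansion _ _ (by linarith) _ _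
  have hφc : Continuous φ := by fun_prop
  have hsub := (hu.1 z₀ (by linarith)).2 r φ hr ⟨p', M + 2, 1, by linarith, one_pos, hφexp⟩
    hφc.continuousOn (by simp [hφ]) (by
      rintro z ⟨hz, hne⟩
      rw [Metric.mem_ball, dist_eq_norm] at hz
      have h1 : u z - q z ≤ u z₀ - q z₀ := hmax (by
        rw [Metric.mem_closedBall, dist_eq_norm]
        have := norm_add_le (z - z₀) (z₀ - x)
        rw [sub_add_sub_cancel] at this
        linarith)
      have h2 : 0 < ‖z - z₀‖ ^ 2 := by
        have := norm_pos_iff.2 (sub_ne_zero.2 hne)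
        positivity
      have h3 := norm_add_sq_expand (z₀ - x) (z - z₀) (M + 1)
      have h4 : z - x = (z₀ - x) + (z - z₀) := by abel
      simp only [hq, hφ, hp'] at h1 ⊢
      rw [h4] at h1
      rw [inner_add_right] at h1
      rw [inner_add_left]
      linarith)
  rw [infFracLaplacian_eq_integral ((hφexp.cutIn hr).hasGradientAt (lt_min one_pos hr)) hp'0,
    ← hvdef] at hsub
  have hin : ∀ η, 0 < η → η < r → ∀ v : E N, ‖v‖ = 1 → z₀ + η • v ∈ Metric.ball z₀ r :=
    fun η h1 h2 v hv => by simpa [norm_smul, hv, abs_of_pos h1] using h2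
  have hout : ∀ η, r ≤ η → ∀ v : E N, ‖v‖ = 1 → z₀ + η • v ∉ Metric.ball z₀ r :=
    fun η h1 v hv => by simpa [norm_smul, hv, abs_of_pos (hr.trans_le h1)] using h1
  have hv' : ‖-v‖ = 1 := by rwa [norm_neg]
  have hneg : ∀ η : ℝ, z₀ - η • v = z₀ + η • (-v) := fun η => by rw [smul_neg, sub_eq_add_neg]
  -- Outside the ball the cut function is `u`. It is at most `U` ahead and `Γp` behind, while `u z₀
  -- > Γp z₀ - τ`.
  have hbig : ∀ η, r ≤ η → cutIn u φ z₀ r (z₀ + η • v) + cutIn u φ z₀ r (z₀ - η • v)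
      - 2 * cutIn u φ z₀ r z₀ ≤ 2 * (M + 2) * min (η ^ 2) 1
        - (Γp (z₀ + η • v) - U (z₀ + η • v)) := fun η hη => by
    have h1 : 2 * τ ≤ 2 * min (η ^ 2) 1 := by
      have h2 : r ^ 2 ≤ η ^ 2 := pow_le_pow_left₀ hr.le hη 2
      have h3 : τ ≤ min (η ^ 2) 1 := le_min (by linarith) (by nlinarith)
      linarith
    have h4 : u (z₀ + η • v) ≤ U (z₀ + η • v) := le_obstacleSolution hu _
    have h5 : Γp (z₀ + η • v) + Γp (z₀ - η • v) - 2 * Γp z₀ ≤ 2 * (M + 1) * min (η ^ 2) 1 := by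
      rcases le_total (η ^ 2) 1 with h | h
      · rw [min_eq_left h]
        have := second_diff_le_of_support hΓp hsup (x := z₀) hv η
        nlinarith [sq_nonneg η]
      · rw [min_eq_right h]
        linarith [H.upper_le_one (z₀ + η • v), H.upper_le_one (z₀ - η • v), H.lower_nonneg z₀,
          H.lower_lt_upper z₀]
    rw [cutIn_self hr, cutIn_of_notMem (hout η hη v hv), hneg, cutIn_of_notMem (hout η hη _ hv'),
      ← hneg]
    have h6 : φ z₀ = u z₀ := by simp [hφ]
    linarith [hu.2.2 (z₀ - η • v)]
  obtain ⟨B, hB⟩ := exists_abs_cutIn_le (H.abs_le_one hu.2.1 hu.2.2)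
    (hφc.continuousOn (s := Metric.closedBall z₀ r))
  have hmeas := measurable_cutIn husc.measurable (hφc.continuousOn (s := Metric.closedBall z₀ r))
  -- The gap `Γp - U` varies by at most `2 * L` times distance: `δ / 4` is lost to the change of
  -- base point and direction, and `δ / 4` to moving by `δ / (8 * L)`. This leaves `δ / 2`.
  have hdef := deficit_le_of_integral_nonneg (l := δ / (8 * L)) (d := δ / 2) (A := 2 * (M + 2))
    hs hs1 hr (by positivity) (by rw [div_le_iff₀ (by positivity)]; nlinarith) (by positivity)
    (integrableOn_div_of_abs_le hs hs1 (by fun_prop) fun η hη =>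
      (hφexp.cutIn hr).abs_second_diff_le (lt_min one_pos hr) (by linarith) hB hv hη) hsub
    (fun η hη => ?_) (fun η hη => ?_)
  · have : δ / 2 * (δ / (8 * L)) = δ ^ 2 / (16 * L) := by field_simp; norm_num
    rwa [this, div_le_iff₀ (by positivity), mul_comm _ (16 * L)] at hdef
  · rcases lt_or_ge η r with h | h
    · rw [cutIn_self hr, cutIn_of_mem (hin η hη h v hv), hneg, cutIn_of_mem (hin η hη h _ hv'),
        min_eq_left (by nlinarith)]
      simp only [hφ, add_sub_cancel_left, smul_neg, inner_neg_right, norm_neg, sub_self,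
        inner_zero_right, norm_zero, norm_smul, hv, mul_one, Real.norm_eq_abs, sq_abs]
      apply le_of_eq
      ring
    · linarith [hbig η h, hUp (z₀ + η • v)]
  · have h1 := hbig η hη.1
    have h2 := hWlip (x + r • y) (z₀ + η • v)
    have h3 := norm_add_smul_sub_add_smul_le (x := x) (z := z₀) (v := v) (y := y) (η := η) hv hr.le
    rw [abs_of_nonneg (by linarith [hη.1])] at h3
    have h4 : 2 * L * (η - r) ≤ δ / 4 := by
      have h5 : η - r ≤ δ / (8 * L) := by linarith [hη.2]
      rw [le_div_iff₀ (by positivity)] at h5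
      linarith
    have h6 := mul_le_mul_of_nonneg_left h3 (show 0 ≤ 2 * L by linarith)
    linarith

end Contact
-- Barriers and contact with the lower obstacle
theorem gradient_eq_of_touching {f g : E N → ℝ} {x p p' : E N} (hf : HasGradientAt f p x)
    (hg : HasGradientAt g p' x) (hle : ∀ᶠ z in 𝓝 x, g z ≤ f z) (heq : f x = g x) : p = p' := by
  have h1 : IsLocalMin (f - g) x := by
    filter_upwards [hle] with z hz
    simp only [Pi.sub_apply, heq, sub_self]
    linarith
  have h2 := h1.hasFDerivAt_eq_zero (hf.hasFDerivAt.sub hg.hasFDerivAt)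
  rw [← map_sub] at h2
  exact sub_eq_zero.1 ((map_eq_zero_iff _ (InnerProductSpace.toDual ℝ (E N)).injective).1 h2)

/-- A function lying above a paraboloid that touches it at `z`, and with an
excess over the paraboloid backwards along its slope, is a subsolution at `z`. -/
theorem isSubsolutionAt_of_paraboloid {s A r l d : ℝ} (hs : 0 < s) (hs1 : s < 1)
    (hr : 0 < r) (hl : 0 ≤ l) (hlr : l ≤ r) (hd : 0 ≤ d) {w q : E N → ℝ} {z p : E N}
    (hw : UpperSemicontinuous w) (hq : HasGradientAt q p z) (hp : p ≠ 0)
    (hqw : ∀ y, q y ≤ w y) (hz : q z = w z)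
    (hlow : ∀ η, 0 < η → -(A * min (η ^ 2) 1)
      ≤ w (z + η • (‖p‖⁻¹ • p)) + w (z - η • (‖p‖⁻¹ • p)) - 2 * w z)
    (hlow' : ∀ η ∈ Icc r (r + l), -(A * min (η ^ 2) 1) + d
      ≤ w (z + η • (‖p‖⁻¹ • p)) + w (z - η • (‖p‖⁻¹ • p)) - 2 * w z)
    (hbig : A * (∫ η in Ioi (0 : ℝ), min (η ^ 2) 1 / η ^ (1 + 2 * s)) * (2 * r) ^ (1 + 2 * s)
      < d * l) : IsSubsolutionAt s w z := by
  refine ⟨hw, fun ρ φ hρ hφ _ h0 hlt => ?_⟩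
  obtain ⟨p', M', η₀, -, hη, hexp⟩ := hφ
  have hφw : ∀ y ∈ Metric.ball z ρ, w y ≤ φ y := fun y hy => by
    by_cases hyz : y = z
    · rw [hyz, h0]
    · exact (hlt y ⟨hy, hyz⟩).le
  obtain rfl : p' = p := gradient_eq_of_touching (hexp.hasGradientAt hη) hq
    (by
      filter_upwards [Metric.ball_mem_nhds z hρ] with y hy
      exact (hqw y).trans (hφw y hy)) (h0.trans hz.symm)
  have hcut : ∀ y, w y ≤ cutIn w φ z ρ y := fun y => by
    by_cases hy : y ∈ Metric.ball z ρ
    · rw [cutIn_of_mem hy]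
      exact hφw y hy
    · rw [cutIn_of_notMem hy]
  have hcz : cutIn w φ z ρ z = w z := by rw [cutIn_self hρ, h0]
  rw [infFracLaplacian_eq_integral ((hexp.cutIn hρ).hasGradientAt (lt_min hη hρ)) hp, hcz]
  set v := ‖p'‖⁻¹ • p'
  by_contra! hneg
  -- A non-integrable function has integral `0` by convention, so a negative integral entails
  -- integrability.
  have hint : IntegrableOn (fun η : ℝ => (cutIn w φ z ρ (z + η • v) + cutIn w φ z ρ (z - η • v)
      - 2 * w z) / η ^ (1 + 2 * s)) (Ioi 0) := by
    by_contra hni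
    rw [integral_undef hni] at hneg
    exact lt_irrefl _ hneg
  have hint' := hint.neg
  simp only [Pi.neg_def, ← neg_div] at hint'
  refine absurd (deficit_le_of_integral_nonneg (A := A) hs hs1 hr hl hlr hd hint' ?_ (fun η hη => ?_)
    fun η hη => ?_) (not_le.2 hbig)
  · simp only [neg_div, integral_neg]
    linarith
  · linarith [hlow η hη, hcut (z + η • v), hcut (z - η • v)]
  · linarith [hlow' η hη, hcut (z + η • v), hcut (z - η • v)]

section Contact

variable [NeZero N] {s θ L₀ M L : ℝ} {Γp Γm : E N → ℝ}

set_option maxHeartbeats 800000 in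
-- If the gap behind `x` were larger, its contribution would beat the concavity of a raised tangent
-- paraboloid, making it a valid barrier that lifts `U` above `Γm` at `x`.
theorem ObstacleAssumptions.lower_contact (H : ObstacleAssumptions s θ L₀ Γp Γm) (hs : 0 < s)
    (hs1 : s < 1) (hM : 0 ≤ M) (hL : L₀ ≤ L) (hL0 : 0 < L)
    (hsup : ∀ x, ∃ p, LocalUpperSupport (-Γm) M x p) {x p : E N}
    (hp : LocalUpperSupport (-Γm) M x (-p))
    (hp0 : p ≠ 0) (hx : Γm x = obstacleSolution s Γp Γm x) {r : ℝ} (hr : 0 < r) (hr1 : r < 1 / 2) :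
    (obstacleSolution s Γp Γm (x - r • (‖p‖⁻¹ • p)) - Γm (x - r • (‖p‖⁻¹ • p))) ^ 2
      ≤ 128 * L * (2 * (M + 1) * (∫ η in Ioi (0 : ℝ), min (η ^ 2) 1 / η ^ (1 + 2 * s))
        * (2 * r) ^ (1 + 2 * s)) := by
  have hK := integral_weight_nonneg s
  have hΓm := H.continuous_lower
  have hy := norm_inv_smul_self hp0
  by_contra! hcon
  have hUm := H.le_obstacleSolution_lower (x - r • (‖p‖⁻¹ • p))
  set y := ‖p‖⁻¹ • p with hydef
  set δ := obstacleSolution s Γp Γm (x - r • y) - Γm (x - r • y) with hδ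
  have hδ0 : 0 < δ := by
    refine lt_of_le_of_ne (by linarith) fun h0 => ?_
    rw [← h0, zero_pow two_ne_zero] at hcon
    have := Real.rpow_nonneg (show 0 ≤ 2 * r by linarith) (1 + 2 * s)
    exact absurd (mul_nonneg (by linarith) (mul_nonneg (mul_nonneg (by linarith) hK) this))
      (not_le.2 hcon)
  have hδr : δ ≤ 2 * L * r := by
    have h1 := (abs_le.1 (H.obstacleSolution_lipschitz hs hs1 (x - r • y) x)).2
    have h2 := (abs_le.1 (H.lower_lipschitz (x - r • y) x)).1
    have h3 := mul_le_mul_of_nonneg_right hL hr.le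
    rw [sub_sub_cancel_left, norm_neg, norm_smul, hy, Real.norm_of_nonneg hr.le, mul_one] at h1 h2
    linarith
  obtain ⟨u, hu, hux⟩ := H.exists_lt_of_lt_obstacleSolution
    (show obstacleSolution s Γp Γm (x - r • y) - δ / 2 < obstacleSolution s Γp Γm (x - r • y) by
      linarith)
  -- The competitor must keep a gap on a whole interval, so `u` is replaced by a larger Lipschitz
  -- admissible function.
  obtain ⟨g, hg, hug, hglip⟩ := H.exists_lipschitz_admissible hs hs1 hL hL0 hu
  have hgc : Continuous g := by
    refine (LipschitzWith.of_dist_le' (K := L) fun x z => ?_).continuous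
    rw [Real.dist_eq, dist_eq_norm, abs_le]
    have h1 := hglip x z
    have h2 := hglip z x
    rw [norm_sub_rev] at h2
    constructor <;> linarith
  have hgδ : ∀ z, δ / 2 - 2 * L * ‖z - (x - r • y)‖ ≤ g z - Γm z := fun z => by
    have h1 := hglip (x - r • y) z
    rw [norm_sub_rev] at h1
    have h2 := (abs_le.1 (H.lower_lipschitz z (x - r • y))).2
    have h3 := mul_le_mul_of_nonneg_right hL (norm_nonneg (z - (x - r • y)))
    linarith [hug (x - r • y)]
  obtain ⟨σ, hσ, hdir⟩ := exists_radius_direction hp0 x (-(2 * (M + 1))) (2 * L) r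
    (show 0 < δ / 8 by positivity)
  obtain ⟨σ', hσ', hgap⟩ := H.exists_radius_gap x
  -- The raised paraboloid exceeds `Γm` only where `‖z - x‖ ^ 2 < ε`. There its slope is nonzero
  -- with controlled direction and it stays below `Γp`; `δ / 16` makes the raise small against the
  -- gap.
  set ε := min (min (σ ^ 2) (σ' ^ 2)) (min (δ / 16) ((Γp x - Γm x) / 2)) with hε
  have hε0 : 0 < ε := by
    have := H.lower_lt_upper x
    have h2 : 0 < (Γp x - Γm x) / 2 := by linarith
    positivity
  have hεσ : ε ≤ σ ^ 2 := (min_le_left _ _).trans (min_le_left _ _)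
  have hεσ' : ε ≤ σ' ^ 2 := (min_le_left _ _).trans (min_le_right _ _)
  have hεδ : ε ≤ δ / 16 := (min_le_right _ _).trans (min_le_left _ _)
  have hεg : ε ≤ (Γp x - Γm x) / 2 := (min_le_right _ _).trans (min_le_right _ _)
  set q : E N → ℝ := fun z => Γm x + inner ℝ p (z - x) - (M + 1) * ‖z - x‖ ^ 2 + ε with hq
  have hqΓ : ∀ z, q z + ‖z - x‖ ^ 2 - ε ≤ Γm z := fun z => by
    have := hp.global hΓm.neg hsup (z - x)
    rw [add_sub_cancel, inner_neg_left] at this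
    simp only [hq, Pi.neg_apply] at this ⊢
    linarith
  have hqx : q x = Γm x + ε := by simp [hq]
  have hqexp : ∀ z h : E N, q (z + h)
      = q z + inner ℝ (p + (-(2 * (M + 1))) • (z - x)) h - (M + 1) * ‖h‖ ^ 2 := fun z h => by
    have h3 := norm_add_sq_expand (z - x) h (M + 1)
    have h4 : z + h - x = (z - x) + h := by abel
    simp only [hq]
    rw [h4, h3, inner_add_right, neg_smul, ← sub_eq_add_neg, inner_sub_left]
    ring
  have hqgrad : ∀ z, HasGradientAt q (p + (-(2 * (M + 1))) • (z - x)) z := fun z => by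
    refine HasC11Expansion.hasGradientAt (M := M + 1) one_pos fun h _ => ?_
    rw [hqexp, ← abs_neg, show -(q z + inner ℝ (p + (-(2 * (M + 1))) • (z - x)) h
      - (M + 1) * ‖h‖ ^ 2 - q z - inner ℝ (p + (-(2 * (M + 1))) • (z - x)) h)
      = (M + 1) * ‖h‖ ^ 2 by ring, abs_of_nonneg (by positivity)]
  have hqc : Continuous q := by fun_prop
  have hnear : ∀ z, Γm z < q z → ‖z - x‖ ^ 2 < ε := fun z hz => by linarith [hqΓ z]
  set w : E N → ℝ := fun z => max (g z) (q z) with hw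
  have hwc : UpperSemicontinuous w := (hgc.max hqc).upperSemicontinuous
  have hwm : ∀ z, Γm z ≤ w z := fun z => (hg.2.1 z).trans (le_max_left _ _)
  have hwp : ∀ z, w z ≤ Γp z := fun z => by
    refine max_le (hg.2.2 z) ?_
    by_cases hz : Γm z < q z
    · have h1 := hnear z hz
      have h2 := hgap z (lt_of_pow_lt_pow_left₀ 2 hσ'.le (h1.trans_le hεσ'))
      linarith [hqΓ z, sq_nonneg ‖z - x‖]
    · exact (not_lt.1 hz).trans (H.lower_lt_upper z).le
  have hw1 := H.abs_le_one hwm hwp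
  have hadm : w ∈ admissible s Γp Γm := by
    refine H.mem_admissible_of_touching hs hs1 hwc hwm hwp fun z hz => ?_
    -- Where `g` is the maximum it touches `w` from below; elsewhere the paraboloid does, and the
    -- barrier criterion applies to `w` itself.
    rcases le_total (q z) (g z) with hqg | hqg
    · rw [show w z = g z from max_eq_left hqg] at hz ⊢
      exact ⟨g, 1, hg.1 z hz, H.abs_le_one hg.2.1 hg.2.2, fun _ => le_max_left _ _, rfl⟩
    have hwz : w z = q z := max_eq_right hqg
    rw [hwz] at hz
    have hzx := hnear z hz
    obtain ⟨hp'0, hdist⟩ := hdir z (lt_of_pow_lt_pow_left₀ 2 hσ.le (hzx.trans_le hεσ))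
    have hv := norm_inv_smul_self hp'0
    have hqz := hqexp z
    have hqz' := hqgrad z
    set p' := p + (-(2 * (M + 1))) • (z - x) with hp'
    set v := ‖p'‖⁻¹ • p' with hvdef
    have hqq : ∀ η : ℝ, q (z + η • v) + q (z - η • v) - 2 * q z = -(2 * (M + 1) * η ^ 2) :=
      fun η => by
        rw [sub_eq_add_neg z, hqz, hqz, norm_neg, inner_neg_right, norm_smul, hv, mul_one,
          Real.norm_eq_abs, sq_abs]
        ring
    refine ⟨w, 1, ?_, hw1, fun _ => le_rfl, rfl⟩
    -- From the gap `δ / 2` of `g`, direction and base point cost `δ / 8`, moving by `δ / (16 * L)`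
    -- costs `δ / 8`, and the raise costs `δ / 16`; at least `δ / 8` remains.
    refine isSubsolutionAt_of_paraboloid (A := 2 * (M + 1)) (r := r) (l := δ / (16 * L))
      (d := δ / 8) hs hs1 hr (by positivity)
      (by rw [div_le_iff₀ (by positivity)]; nlinarith) (by positivity) hwc hqz' hp'0
      (fun _ => le_max_right _ _) hwz.symm (fun η hη => ?_) (fun η hη => ?_) ?_
    · rw [← hvdef, hwz]
      have h1 : q (z + η • v) ≤ w (z + η • v) := le_max_right _ _
      have h2 : q (z - η • v) ≤ w (z - η • v) := le_max_right _ _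
      rcases le_total (η ^ 2) 1 with h | h
      · rw [min_eq_left h]
        linarith [hqq η]
      · rw [min_eq_right h]
        linarith [H.lower_nonneg (z + η • v), H.lower_nonneg (z - η • v), hwm (z + η • v),
          hwm (z - η • v), (abs_le.1 (hw1 z)).2]
    · rw [← hvdef, hwz]
      have hl : δ / (16 * L) ≤ r / 2 := by
        rw [div_le_iff₀ (by positivity)]
        nlinarith
      have hη0 : 0 < η := hr.trans_le hη.1
      have hη1 : η ^ 2 ≤ 1 := pow_le_one₀ hη0.le (by linarith [hη.2])
      rw [min_eq_left hη1]
      have h1 : q (z + η • v) ≤ w (z + η • v) := le_max_right _ _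
      have h2 : g (z - η • v) ≤ w (z - η • v) := le_max_left _ _
      have h3 := hgδ (z - η • v)
      have h4 : ‖z - η • v - (x - r • y)‖ ≤ ‖z - x‖ + |η - r| + r * ‖v - y‖ := by
        have h5 := norm_add_smul_sub_add_smul_le (x := x) (z := z) (v := -v) (y := -y) (η := η)
          (by rwa [norm_neg]) hr.le
        rwa [smul_neg, smul_neg, ← sub_eq_add_neg, ← sub_eq_add_neg, ← neg_sub', norm_neg] at h5
      rw [abs_of_nonneg (by linarith [hη.1])] at h4
      have h5 : 2 * L * (η - r) ≤ δ / 8 := by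
        have h6 : η - r ≤ δ / (16 * L) := by linarith [hη.2]
        rw [le_div_iff₀ (by positivity)] at h6
        linarith
      have h7 := mul_le_mul_of_nonneg_left h4 (show 0 ≤ 2 * L by linarith)
      linarith [hqq η, hqΓ (z - η • v), sq_nonneg ‖z - η • v - x‖]
    · have : δ / 8 * (δ / (16 * L)) = δ ^ 2 / (128 * L) := by field_simp; norm_num
      rwa [this, lt_div_iff₀ (by positivity), mul_comm _ (128 * L)]
  -- The contradiction: `w x ≥ q x = U x + ε`.
  have h1 := le_obstacleSolution hadm x
  have h2 : q x ≤ w x := le_max_right _ _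
  linarith

end Contact

end NonlocalTugOfWar

/-! ### Assembly of the estimates -/

theorem mainTheorem8 (θ : ℝ) (hθ₀ : 0 < θ) (hθ₁ : θ < Real.pi / 2) :
    ∃ A : ℝ, 1 ≤ A ∧
      ∀ (N : ℕ) [NeZero N] (s L₀ : ℝ) (Γp Γm : NonlocalTugOfWar.E N → ℝ),
        1 / 2 < s → s < 1 → NonlocalTugOfWar.ObstacleAssumptions s θ L₀ Γp Γm →
        (∀ x z : NonlocalTugOfWar.E N,
          |NonlocalTugOfWar.obstacleSolution s Γp Γm x
            - NonlocalTugOfWar.obstacleSolution s Γp Γm z| ≤ A * L₀ * ‖x - z‖) ∧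
        (∃ C r₀ : ℝ, 0 < r₀ ∧
          ∀ x y : NonlocalTugOfWar.E N, Γp x = NonlocalTugOfWar.obstacleSolution s Γp Γm x →
            gradient Γp x ≠ 0 → y = ‖gradient Γp x‖⁻¹ • gradient Γp x →
            ∀ r : ℝ, 0 < r → r < r₀ →
              |Γp (x + r • y) - NonlocalTugOfWar.obstacleSolution s Γp Γm (x + r • y)|
                ≤ C * r ^ (1 + (s - 1 / 2))) ∧
        (∃ C r₀ : ℝ, 0 < r₀ ∧
          ∀ x y : NonlocalTugOfWar.E N, Γm x = NonlocalTugOfWar.obstacleSolution s Γp Γm x →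
            gradient Γm x ≠ 0 → y = ‖gradient Γm x‖⁻¹ • gradient Γm x →
            ∀ r : ℝ, 0 < r → r < r₀ →
              |NonlocalTugOfWar.obstacleSolution s Γp Γm (x - r • y) - Γm (x - r • y)|
                ≤ C * r ^ (1 + (s - 1 / 2))) := by
  refine ⟨1, le_rfl, fun N _ s L₀ Γp Γm hs hs1 H => ?_⟩
  have hs0 : 0 < s := by linarith
  -- The contact estimates divide by the Lipschitz constant, so `L₀` is replaced there by a positive
  -- majorant.
  have hL0 : 0 < |L₀| + 1 := by positivity
  have hL : L₀ ≤ |L₀| + 1 := by linarith [le_abs_self L₀]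
  have hK := NonlocalTugOfWar.integral_weight_nonneg s
  have h2 : (0 : ℝ) ≤ 2 ^ (1 + 2 * s) := by positivity
  refine ⟨fun x z => ?_, ?_, ?_⟩
  · rw [one_mul]
    exact H.obstacleSolution_lipschitz hs0 hs1 x z
  · obtain ⟨M, hM, hsup, hgrad⟩ := H.upper_C11.exists_upper_support H.upper_le_one
    refine ⟨√(16 * (|L₀| + 1) * (2 * (M + 2) * (∫ η in Set.Ioi (0 : ℝ),
      min (η ^ 2) 1 / η ^ (1 + 2 * s)) * 2 ^ (1 + 2 * s))), 1 / 2, by norm_num, fun x y hx hp hy r hr hr1 => ?_⟩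
    have key := H.upper_contact hs0 hs1 hM.le hL hL0 hsup (hgrad x hp) hp hx hr hr1
    rw [hy, abs_of_nonneg (sub_nonneg.2 (H.obstacleSolution_le _))]
    refine NonlocalTugOfWar.le_sqrt_mul_rpow hr ?_ (key.trans_eq ?_)
    · exact mul_nonneg (by linarith) (mul_nonneg (mul_nonneg (by linarith) hK) h2)
    · rw [Real.mul_rpow zero_le_two hr.le]
      ring
  · obtain ⟨M, hM, hsup, hgrad⟩ := H.lower_C11.neg.exists_upper_support
      fun x => by simpa using H.lower_nonneg x
    refine ⟨√(128 * (|L₀| + 1) * (2 * (M + 1) * (∫ η in Set.Ioi (0 : ℝ),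
      min (η ^ 2) 1 / η ^ (1 + 2 * s)) * 2 ^ (1 + 2 * s))), 1 / 2, by norm_num, fun x y hx hp hy r hr hr1 => ?_⟩
    have hsupp := hgrad x (by rwa [NonlocalTugOfWar.gradient_neg, neg_ne_zero])
    rw [NonlocalTugOfWar.gradient_neg] at hsupp
    have key := H.lower_contact hs0 hs1 hM.le hL hL0 hsup hsupp hp hx hr hr1
    rw [hy, abs_of_nonneg (sub_nonneg.2 (H.le_obstacleSolution_lower _))]
    refine NonlocalTugOfWar.le_sqrt_mul_rpow hr ?_ (key.trans_eq ?_)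
    · exact mul_nonneg (by linarith) (mul_nonneg (mul_nonneg (by linarith) hK) h2)
    · rw [Real.mul_rpow zero_le_two hr.le]
      ring
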